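/- Let $X=(X_t)_{t\ge 0}$ be a strong Markov process on $\mathbb R$ with right-continuous paths, with respect to a right-continuous filtration $(\mathcal F_t)_{t\ge0}$ and with the associated family $(\mathbb P_x)_{x\in\mathbb R}$ of probability measures, $\mathbb P_x(X_0=x)=1$; write $\mathbb E_x$ for the expectation under $\mathbb P_x$ and $\tau_y:=\inf\{t\ge 0 : X_t>y\}$ for the first passage time above $y$. Let $\gamma:\mathbb R\to\mathbb R$ be non-decreasing and differentiable, and let $h:\mathbb R\to[0,\infty)$ be continuous with $\mathbb E_x\int_0^{\tau_y}h(X_s)\,ds<\infty$ for all $x<y$. Let $\mathcal T$ be the set of all stopping times $\tau$ with $\mathbb E_x\tau<\infty$ and $\mathbb E_x\int_0^\tau h(X_s)\,ds<\infty$ for all $x\in\mathbb R$, and let $$\mathcal V(x):=\sup_{\tau\in\mathcal T}\mathbb E_x\Big[\gamma(X_\tau)-\int_0^\tau h(X_s)\,ds\Big]\in[-\infty,\infty],\qquad x\in\mathbb R,$$ where an expectation whose negative part is infinite counts as $-\infty$. Assume that there are a Borel function $f:\mathbb R\to\mathbb R$ and a point $\bar x\in\mathbb R$ such that: 1. (maximum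 representation) for all $x\le y$, $\tau_y<\infty$ $\mathbb P_x$-almost surely, the random variables $\int_0^{\tau_y}|f(\sup_{r\le t}X_r)|\,dt$ and $\gamma(X_{\tau_y})-\int_0^{\tau_y}h(X_s)\,ds$ are $\mathbb P_x$-integrable, and $$\gamma(x)=-\mathbb E_x\Big[\int_0^{\tau_y}f\Big(\sup_{r\le t}X_r\Big)dt\Big]+\mathbb E_x\Big[\gamma(X_{\tau_y})-\int_0^{\tau_y}h(X_s)\,ds\Big];$$ 2. $f>0$ on $(-\infty,\bar x)$, $f(\bar x)=0$, and $f$ is strictly decreasing on $[\bar x,\infty)$ (so that $\bar x$ is the unique root of $f$). Assume also that $\mathbb E_x\tau_{\bar x}<\infty$ for all $x\in\mathbb R$. Then the threshold time $\tau_{\bar x}$ belongs to $\mathcal T$ and is optimal: for all $x\in\mathbb R$, the random variable $\gamma(X_{\tau_{\bar x}})-\int_0^{\tau_{\bar x}}h(X_s)\,ds$ is $\mathbb P_x$-integrable and $$\mathcal V(x)=\mathbb E_x\Big[\gamma(X_{\tau_{\bar x}})-\int_0^{\tau_{\bar x}}h(X_s)\,ds\Big].$$ -/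

import Mathlib

open MeasureTheory
open scoped NNReal ENNReal

namespace OptStop

noncomputable section

variable {Ω : Type*} {m : MeasurableSpace Ω}

/-- A strong Markov process on the real line: a real process `X` in continuous time with
right-continuous paths, adapted to the right-continuous filtration `F`, with a family of probability
measures `P x`, under which `X` starts in `x`. The law of the path depends measurably on the starting
point, and at every stopping time `τ`, on `{τ < ∞}`, the conditional law of the path
`t ↦ X (τ + t)` given the `σ`-algebra of the past of `τ` is the law of the path under
`P (X τ)`. -/
structure IsStrongMarkov (X : ℝ≥0 → Ω → ℝ) (P : ℝ → Measure Ω) (F : Filtration ℝ≥0 m) : Prop where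
  isProbabilityMeasure : ∀ x, IsProbabilityMeasure (P x)
  start : ∀ x, ∀ᵐ ω ∂(P x), X 0 ω = x
  rightContinuous_filtration : F.IsRightContinuous
  adapted : Adapted F X
  rightContinuous_paths : ∀ ω t, ContinuousWithinAt (fun s => X s ω) (Set.Ici t) t
  measurable_law : ∀ B : Set (ℝ≥0 → ℝ), MeasurableSet B →
    Measurable fun x => P x {ω | (fun t => X t ω) ∈ B}
  strong_markov : ∀ (τ : Ω → WithTop ℝ≥0) (hτ : IsStoppingTime F τ) (x : ℝ) (A : Set Ω)
    (B : Set (ℝ≥0 → ℝ)), MeasurableSet[hτ.measurableSpace] A → MeasurableSet B →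
    P x {ω | ω ∈ A ∧ τ ω < ⊤ ∧ (fun t => X ((τ ω).untopA + t) ω) ∈ B} =
      ∫⁻ ω in {ω | ω ∈ A ∧ τ ω < ⊤}, P (stoppedValue X τ ω) {ω' | (fun t => X t ω') ∈ B} ∂(P x)

/-- The first passage time `τ_y = inf {t ≥ 0 | X t > y}` (which is `⊤` if there is no such `t`). -/
def firstPassage (X : ℝ≥0 → Ω → ℝ) (y : ℝ) : Ω → WithTop ℝ≥0 :=
  hittingAfter X (Set.Ioi y) 0

/-- The time interval `[0, T)`, as a set of reals, for `T ∈ [0, ∞]`. -/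
def timesBefore (T : WithTop ℝ≥0) : Set ℝ :=
  {s | 0 ≤ s ∧ (s.toNNReal : WithTop ℝ≥0) < T}

/-- The pathwise integral `∫_0^τ Y_s ds` of a real process `Y`. -/
def timeIntegral (Y : ℝ≥0 → Ω → ℝ) (τ : Ω → WithTop ℝ≥0) (ω : Ω) : ℝ :=
  ∫ s in timesBefore (τ ω), Y s.toNNReal ω

/-- The expectation `E (∫_0^τ |Y_s| ds)` in `[0, ∞]` under `μ`. -/
def expectedAbsIntegral (μ : Measure Ω) (Y : ℝ≥0 → Ω → ℝ) (τ : Ω → WithTop ℝ≥0) : ℝ≥0∞ :=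
  ∫⁻ ω, ∫⁻ s in timesBefore (τ ω), ENNReal.ofReal |Y s.toNNReal ω| ∂volume ∂μ

/-- The expectation `E τ` in `[0, ∞]` under `μ`. -/
def expectedTime (μ : Measure Ω) (τ : Ω → WithTop ℝ≥0) : ℝ≥0∞ :=
  ∫⁻ ω, @id ℝ≥0∞ (τ ω) ∂μ

/-- The running maximum `sup_{r ≤ t} X_r`. -/
def runningMax (X : ℝ≥0 → Ω → ℝ) (t : ℝ≥0) (ω : Ω) : ℝ :=
  sSup ((fun r => X r ω) '' Set.Iic t)

/-- The net reward `γ (X_τ) - ∫_0^τ h (X_s) ds`. -/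
def netReward (X : ℝ≥0 → Ω → ℝ) (γ h : ℝ → ℝ) (τ : Ω → WithTop ℝ≥0) (ω : Ω) : ℝ :=
  γ (stoppedValue X τ ω) - timeIntegral (fun s ω => h (X s ω)) τ ω

/-- The admissible stopping times: stopping times `τ` with `E_x τ < ∞` and
`E_x (∫_0^τ h (X_s) ds) < ∞` for all `x` (here `h` is non-negative). -/
def admissible (X : ℝ≥0 → Ω → ℝ) (P : ℝ → Measure Ω) (F : Filtration ℝ≥0 m) (h : ℝ → ℝ) :
    Set (Ω → WithTop ℝ≥0) :=
  {τ | IsStoppingTime F τ ∧ ∀ x, expectedTime (P x) τ < ∞ ∧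
    expectedAbsIntegral (P x) (fun s ω => h (X s ω)) τ < ∞}

/-- The extended expectation `E Z⁺ - E Z⁻`. It is `⊥` as soon as `E Z⁻ = ∞`, so that in
particular a random variable without an expectation never contributes to a supremum. -/
def extExpectation (μ : Measure Ω) (Z : Ω → ℝ) : EReal :=
  ((∫⁻ ω, ENNReal.ofReal (Z ω) ∂μ : ℝ≥0∞) : EReal) -
    ((∫⁻ ω, ENNReal.ofReal (-Z ω) ∂μ : ℝ≥0∞) : EReal)

/-- The value function: the supremum of the expected net rewards over all admissible stopping
times. -/
def value (X : ℝ≥0 → Ω → ℝ) (P : ℝ → Measure Ω) (F : Filtration ℝ≥0 m) (γ h : ℝ → ℝ)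
    (x : ℝ) : EReal :=
  ⨆ τ ∈ admissible X P F h, extExpectation (P x) (netReward X γ h τ)

/-- The function `f` gives a maximum representation of `γ`: for all `x ≤ y`, the passage time `τ_y`
is almost surely finite under `P x`, the expectations below exist, and
`γ x = - E_x (∫_0^{τ_y} f (sup_{r ≤ t} X_r) dt) + E_x (γ (X_{τ_y}) - ∫_0^{τ_y} h (X_s) ds)`. -/
def HasMaxRepresentation (X : ℝ≥0 → Ω → ℝ) (P : ℝ → Measure Ω) (γ h f : ℝ → ℝ) : Prop :=
  ∀ y x : ℝ, x ≤ y →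
    (∀ᵐ ω ∂(P x), firstPassage X y ω < ⊤) ∧
    expectedAbsIntegral (P x) (fun t ω => f (runningMax X t ω)) (firstPassage X y) < ∞ ∧
    Integrable (netReward X γ h (firstPassage X y)) (P x) ∧
    γ x = -(∫ ω, timeIntegral (fun t ω => f (runningMax X t ω)) (firstPassage X y) ω ∂(P x)) +
      ∫ ω, netReward X γ h (firstPassage X y) ω ∂(P x)

end

end OptStop

/-!
Let `b` be the root of `f`, write `f⁻` for the negative part of `f`, which vanishes up to `b` and is
non-decreasing, and fix a level `y` above `b` and above the starting point `x`. For a starting point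
`z ≤ y`, dropping the positive part of `f` in the maximum representation gives
`γ z ≤ E_z (∫_0^{τ_y} f⁻ (sup_{r ≤ t} X_r) dt + γ (X_{τ_y}) - ∫_0^{τ_y} h (X_s) ds)`,
with equality if `b ≤ z` (`HasMaxRepresentation.lintegral_eq`). By the strong Markov property this
may be applied to the path restarted at a stopping time `τ`, on `{τ < τ_y}`.

* Restarting lowers the running maximum, hence also `f⁻` at the running maximum. So the reward of
  stopping at `τ`, truncated at the level `γ y`, has expectation at most
  `E_x (∫_0^{τ_y} f⁻ (sup_{r ≤ t} X_r) dt + γ (X_{τ_y}) - ∫_0^{τ_y} h (X_s) ds)`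
  (`HasMaxRepresentation.lintegral_costBefore_le`).
* For `τ = τ_b` nothing is lost: before `τ_b` the running maximum stays below `b`, where `f⁻`
  vanishes, and at `τ_b` the path is at its running maximum. So the upper bound is at most the
  expected reward of `τ_b` (`HasMaxRepresentation.lintegral_firstPassage_le`).

Letting `y` tend to infinity, monotone convergence removes the truncation
(`HasMaxRepresentation.extExpectation_le`); no assumption on the explosion of the paths is needed,
because `γ` is monotone: at `τ_y` the truncation level `γ y` has already been reached.

All comparisons are between integrals in `[0, ∞]`: the terms of the representation are moved to the
side where they are non-negative, with `γ` measured from the reference value `γ y`. To apply the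
strong Markov property to functionals such as `τ_y`, which are not measurable for the product
`σ`-algebra on all paths, it is transferred to the space of right-continuous paths
(`IsStrongMarkov.setLIntegral_shiftPath`).
-/

namespace OptStop

noncomputable section

/-! ### First passage times and running maxima of right-continuous processes -/

section Passage

variable {Ω : Type*} {X : ℝ≥0 → Ω → ℝ} {y : ℝ} {ω : Ω}

lemma firstPassage_lt_iff {T : WithTop ℝ≥0} :
    firstPassage X y ω < T ↔ ∃ r : ℝ≥0, (r : WithTop ℝ≥0) < T ∧ y < X r ω := by
  constructor
  · intro hlt
    by_contra! hc
    by_cases hex : ∃ j : ℝ≥0, 0 ≤ j ∧ X j ω ∈ Set.Ioi y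
    · rw [firstPassage, hittingAfter, if_pos hex] at hlt
      have hne : {i : ℝ≥0 | 0 ≤ i ∧ X i ω ∈ Set.Ioi y}.Nonempty := hex
      obtain ⟨c, hc1, hc2⟩ : ∃ c ∈ {i : ℝ≥0 | 0 ≤ i ∧ X i ω ∈ Set.Ioi y},
          (c : WithTop ℝ≥0) < T := by
        rcases eq_or_ne T ⊤ with rfl | hT
        · obtain ⟨c, hc⟩ := hne
          exact ⟨c, hc, WithTop.coe_lt_top c⟩
        · lift T to ℝ≥0 using hT
          obtain ⟨c, hc, hcT⟩ := exists_lt_of_csInf_lt hne (WithTop.coe_lt_coe.1 hlt)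
          exact ⟨c, hc, WithTop.coe_lt_coe.2 hcT⟩
      exact absurd hc1.2 (not_lt.2 (hc c hc2))
    · rw [firstPassage, hittingAfter, if_neg hex] at hlt
      exact not_top_lt hlt
  · rintro ⟨r, hr, hy⟩
    exact lt_of_le_of_lt (hittingAfter_le_of_mem zero_le hy) hr

lemma le_firstPassage_iff {T : WithTop ℝ≥0} :
    T ≤ firstPassage X y ω ↔ ∀ r : ℝ≥0, (r : WithTop ℝ≥0) < T → X r ω ≤ y := by
  rw [← not_lt, firstPassage_lt_iff]
  push Not
  rfl

lemma le_of_lt_firstPassage {r : ℝ≥0} (hr : (r : WithTop ℝ≥0) < firstPassage X y ω) :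
    X r ω ≤ y :=
  le_firstPassage_iff.1 le_rfl r hr

lemma firstPassage_mono {y' : ℝ} (h : y ≤ y') : firstPassage X y ω ≤ firstPassage X y' ω :=
  le_firstPassage_iff.2 fun _ hr =>
    (le_of_lt_firstPassage hr).trans h

lemma le_apply_firstPassage (hX : ∀ ω t, ContinuousWithinAt (fun s => X s ω) (Set.Ici t) t)
    {T : ℝ≥0} (hT : firstPassage X y ω = T) : y ≤ X T ω := by
  by_contra! hlt
  have h1 : ∀ᶠ s in nhdsWithin T (Set.Ici T), X s ω < y := (hX ω T).eventually_lt_const hlt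
  obtain ⟨u, hu, hsub⟩ := (mem_nhdsGE_iff_exists_Ico_subset).1 h1
  have h2 : firstPassage X y ω < (u : WithTop ℝ≥0) := by
    rw [hT]; exact_mod_cast hu
  obtain ⟨r, hr, hy⟩ := firstPassage_lt_iff.1 h2
  rcases lt_or_ge r T with hrT | hrT
  · exact absurd hy (not_lt.2 (le_of_lt_firstPassage (by rw [hT]; exact_mod_cast hrT)))
  · exact absurd hy (not_lt.2 (hsub ⟨hrT, by exact_mod_cast hr⟩ : X r ω < y).le)

/-- The first passage time of the path restarted at a time `T` before the passage is the remaining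
waiting time. -/
lemma firstPassage_shift {T : ℝ≥0} (hT : (T : WithTop ℝ≥0) < firstPassage X y ω) :
    firstPassage X y ω = T + firstPassage (fun t => X (T + t)) y ω := by
  apply le_antisymm
  · by_contra! hlt
    obtain ⟨c, hc, hcy⟩ : ∃ r : ℝ≥0, ((T + r : ℝ≥0) : WithTop ℝ≥0) < firstPassage X y ω ∧
        y < X (T + r) ω := by
      have h3 : firstPassage (fun t => X (T + t)) y ω < ⊤ :=
        lt_top_iff_ne_top.2 fun h => by
          rw [h, WithTop.add_top] at hlt
          exact not_top_lt hlt
      rcases eq_or_ne (firstPassage X y ω) ⊤ with htop | htop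
      · obtain ⟨r, -, hr⟩ := firstPassage_lt_iff.1 h3
        exact ⟨r, htop ▸ WithTop.coe_lt_top _, hr⟩
      · lift firstPassage (fun t => X (T + t)) y ω to ℝ≥0 using h3.ne with d hd
        lift firstPassage X y ω to ℝ≥0 using htop with e he
        have hlt' : T + d < e := by exact_mod_cast hlt
        have : firstPassage (fun t => X (T + t)) y ω < ((e - T : ℝ≥0) : WithTop ℝ≥0) := by
          rw [← hd]; exact_mod_cast lt_tsub_iff_left.2 hlt'
        obtain ⟨r, hr, hry⟩ := firstPassage_lt_iff.1 this
        refine ⟨r, ?_, hry⟩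
        exact_mod_cast lt_tsub_iff_left.1 (by exact_mod_cast hr : r < e - T)
    exact absurd hcy (not_lt.2 (le_of_lt_firstPassage hc))
  · rw [le_firstPassage_iff]
    intro r hr
    rcases lt_or_ge r T with hrT | hrT
    · exact le_of_lt_firstPassage (lt_trans (by exact_mod_cast hrT) hT)
    · obtain ⟨s, rfl⟩ := exists_add_of_le hrT
      refine le_of_lt_firstPassage (X := fun t => X (T + t)) ?_
      by_contra! hs
      refine absurd hr (not_lt.2 ?_)
      push_cast
      gcongr

end Passage

section Measurability

variable {Ω : Type*} {m : MeasurableSpace Ω} {X : ℝ≥0 → Ω → ℝ}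

/-- A right-continuous process is the limit of its values on the grids `ℕ / (n + 1)`, sampled
strictly to the right of the current time; hence it is jointly measurable. -/
lemma measurable_uncurry_of_rightContinuous (hm : ∀ t, Measurable (X t))
    (hX : ∀ ω t, ContinuousWithinAt (fun s => X s ω) (Set.Ici t) t) :
    Measurable fun p : ℝ≥0 × Ω => X p.1 p.2 := by
  have hgrid : ∀ e : ℕ → ℝ≥0, ∀ c : ℝ≥0,
      Measurable fun p : ℝ≥0 × Ω => X (e ⌊p.1 * c⌋₊) p.2 := fun e c => by
    have h1 : Measurable fun q : ℕ × Ω => X (e q.1) q.2 :=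
      measurable_from_prod_countable_right fun k => hm (e k)
    have h2 : Measurable fun p : ℝ≥0 × Ω => (⌊p.1 * c⌋₊, p.2) :=
      (Nat.measurable_floor.comp (measurable_fst.mul_const _)).prodMk measurable_snd
    exact h1.comp h2
  let d : ℕ → ℝ≥0 → ℝ≥0 := fun n t => ((⌊t * (n + 1)⌋₊ : ℝ≥0) + 1) / (n + 1)
  have hle : ∀ n t, t ≤ d n t := fun n t => by
    rw [le_div_iff₀ (by positivity)]
    exact (Nat.lt_floor_add_one _).le
  have hge : ∀ n t, d n t ≤ t + 1 / (n + 1) := fun n t => by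
    rw [div_le_iff₀ (by positivity), add_mul, one_div, inv_mul_cancel₀ (by positivity)]
    gcongr
    exact Nat.floor_le zero_le
  refine measurable_of_tendsto_metrizable (f := fun n (p : ℝ≥0 × Ω) => X (d n p.1) p.2)
    (fun n => ?_) ?_
  · exact hgrid (fun k => ((k : ℝ≥0) + 1) / (n + 1)) (n + 1)
  · rw [tendsto_pi_nhds]
    rintro ⟨t, ω⟩
    have h3 : Filter.Tendsto (fun n : ℕ => t + 1 / ((n : ℝ≥0) + 1)) Filter.atTop (nhds t) := by
      simpa using (tendsto_one_div_add_atTop_nhds_zero_nat (𝕜 := ℝ≥0)).const_add t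
    have h4 : Filter.Tendsto (fun n => d n t) Filter.atTop (nhds t) :=
      tendsto_of_tendsto_of_tendsto_of_le_of_le tendsto_const_nhds h3
        (fun n => hle n t) (fun n => hge n t)
    have h5 : Filter.Tendsto (fun n => d n t) Filter.atTop (nhdsWithin t (Set.Ici t)) :=
      tendsto_nhdsWithin_iff.2 ⟨h4, .of_forall fun n => hle n t⟩
    have h6 : Filter.Tendsto (fun s => X s ω) (nhdsWithin t (Set.Ici t)) (nhds (X t ω)) := hX ω t
    exact h6.comp h5

/-- The running maximum of a right-continuous path is a supremum over countably many times. -/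
lemma runningMax_eq_iSup (hX : ∀ ω t, ContinuousWithinAt (fun s => X s ω) (Set.Ici t) t)
    (t : ℝ≥0) (ω : Ω) :
    runningMax X t ω = ⨆ n : ℕ, X (min (TopologicalSpace.denseSeq ℝ≥0 n) t) ω := by
  -- An upper bound along the dense times is an upper bound, so both suprema agree; if there is no
  -- upper bound, both have the junk value `0`.
  have hub : upperBounds ((fun r => X r ω) '' Set.Iic t) =
      upperBounds (Set.range fun n => X (min (TopologicalSpace.denseSeq ℝ≥0 n) t) ω) := by
    ext b
    simp only [mem_upperBounds, Set.forall_mem_image, Set.forall_mem_range, Set.mem_Iic]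
    refine ⟨fun h n => h (min_le_right _ _), fun h r hr => ?_⟩
    by_contra! hlt
    have h1 : ∀ᶠ s in nhdsWithin r (Set.Ici r), b < X s ω := (hX ω r).eventually_const_lt hlt
    obtain ⟨u, hu, hsub⟩ := (mem_nhdsGE_iff_exists_Ico_subset).1 h1
    obtain ⟨_, ⟨n, rfl⟩, hq⟩ := (TopologicalSpace.denseRange_denseSeq ℝ≥0).exists_between hu
    refine absurd (h n) (not_le.2 (hsub ⟨le_min hq.1.le hr, (min_le_left _ _).trans_lt hq.2⟩))
  by_cases hb : BddAbove ((fun r => X r ω) '' Set.Iic t)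
  · have h1 : IsLUB ((fun r => X r ω) '' Set.Iic t) (runningMax X t ω) :=
      isLUB_csSup ⟨_, Set.mem_image_of_mem _ (Set.mem_Iic.2 le_rfl)⟩ hb
    have h2 : IsLUB (Set.range fun n => X (min (TopologicalSpace.denseSeq ℝ≥0 n) t) ω)
        (runningMax X t ω) := by rwa [IsLUB, ← hub]
    exact (h2.csSup_eq (Set.range_nonempty _)).symm
  · rw [runningMax, Real.sSup_of_not_bddAbove hb, iSup, Real.sSup_of_not_bddAbove]
    rwa [BddAbove, ← hub]

lemma measurable_runningMax (hm : ∀ t, Measurable (X t))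
    (hX : ∀ ω t, ContinuousWithinAt (fun s => X s ω) (Set.Ici t) t) :
    Measurable fun p : ℝ≥0 × Ω => runningMax X p.1 p.2 := by
  simp_rw [runningMax_eq_iSup hX]
  refine .iSup fun n => ?_
  exact (measurable_uncurry_of_rightContinuous hm hX).comp
    ((measurable_const.min measurable_fst).prodMk measurable_snd)

/-- The first passage time above a level is a stopping time: by right-continuity,
`{τ_y < t}` is the union of the events `{X_q > y}` over countably many times `q < t`. -/
lemma isStoppingTime_firstPassage {F : Filtration ℝ≥0 m} (hF : F.IsRightContinuous)
    (hm : Adapted F X) (hX : ∀ ω t, ContinuousWithinAt (fun s => X s ω) (Set.Ici t) t) (y : ℝ) :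
    IsStoppingTime F (firstPassage X y) := by
  refine isStoppingTime_of_measurableSet_lt_of_isRightContinuous fun i => ?_
  have : {ω | firstPassage X y ω < i} =
      ⋃ n : ℕ, ⋃ (_ : TopologicalSpace.denseSeq ℝ≥0 n < i),
        X (TopologicalSpace.denseSeq ℝ≥0 n) ⁻¹' Set.Ioi y := by
    ext ω
    simp only [Set.mem_ofPred_eq, firstPassage_lt_iff, Set.mem_iUnion, Set.mem_preimage,
      Set.mem_Ioi, exists_prop, WithTop.coe_lt_coe]
    constructor
    · rintro ⟨r, hri, hr⟩
      have h1 : ∀ᶠ s in nhdsWithin r (Set.Ici r), y < X s ω := (hX ω r).eventually_const_lt hr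
      obtain ⟨u, hu, hsub⟩ := (mem_nhdsGE_iff_exists_Ico_subset).1 h1
      obtain ⟨_, ⟨n, rfl⟩, hq⟩ :=
        (TopologicalSpace.denseRange_denseSeq ℝ≥0).exists_between (lt_min hu hri)
      exact ⟨n, hq.2.trans_le (min_le_right _ _),
        hsub ⟨hq.1.le, hq.2.trans_le (min_le_left _ _)⟩⟩
    · rintro ⟨n, h⟩
      exact ⟨_, h⟩
  rw [this]
  refine .iUnion fun n => .iUnion fun hn => ?_
  exact F.mono hn.le _ (hm _ measurableSet_Ioi)

lemma measurable_firstPassage (hm : ∀ t, Measurable (X t))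
    (hX : ∀ ω t, ContinuousWithinAt (fun s => X s ω) (Set.Ici t) t) (y : ℝ) :
    Measurable (firstPassage X y) := by
  -- The constant filtration is right-continuous, and its stopping times are measurable.
  let F : Filtration ℝ≥0 m := ⟨fun _ => m, fun _ _ _ => le_rfl, fun _ => le_rfl⟩
  exact (isStoppingTime_firstPassage (F := F) ⟨fun i => F.rightCont.le i⟩ hm hX y).measurable'

lemma measurable_stoppedValue_of_rightContinuous (hm : ∀ t, Measurable (X t))
    (hX : ∀ ω t, ContinuousWithinAt (fun s => X s ω) (Set.Ici t) t) {τ : Ω → WithTop ℝ≥0}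
    (hτ : Measurable τ) : Measurable (stoppedValue X τ) :=
  (measurable_uncurry_of_rightContinuous hm hX).comp (hτ.untopA.prodMk measurable_id)

/-- The pathwise integral `∫_0^τ Y_s ds` of a process with values in `[0, ∞]`. -/
def lTimeIntegral (Y : ℝ≥0 → Ω → ℝ≥0∞) (τ : Ω → WithTop ℝ≥0) (ω : Ω) : ℝ≥0∞ :=
  ∫⁻ s in timesBefore (τ ω), Y s.toNNReal ω

lemma measurableSet_timesBefore (T : WithTop ℝ≥0) : MeasurableSet (timesBefore T) :=
  (measurableSet_Ici (a := (0 : ℝ))).inter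
    (measurableSet_lt (WithTop.measurable_coe.comp measurable_real_toNNReal) measurable_const)

lemma timesBefore_mono {S T : WithTop ℝ≥0} (h : S ≤ T) : timesBefore S ⊆ timesBefore T :=
  fun _ hs => ⟨hs.1, hs.2.trans_le h⟩

lemma measurable_lTimeIntegral {Y : ℝ≥0 → Ω → ℝ≥0∞} {τ : Ω → WithTop ℝ≥0}
    (hY : Measurable fun p : ℝ≥0 × Ω => Y p.1 p.2) (hτ : Measurable τ) :
    Measurable (lTimeIntegral Y τ) := by
  have hS : MeasurableSet {p : Ω × ℝ | p.2 ∈ timesBefore (τ p.1)} :=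
    (measurableSet_le measurable_const measurable_snd).inter
      (measurableSet_lt (WithTop.measurable_coe.comp
        (measurable_real_toNNReal.comp measurable_snd)) (hτ.comp measurable_fst))
  have h2 : Measurable fun p : Ω × ℝ => Y p.2.toNNReal p.1 :=
    hY.comp ((measurable_real_toNNReal.comp measurable_snd).prodMk measurable_fst)
  have h3 := (h2.indicator hS).lintegral_prod_right' (ν := volume)
  convert! h3 using 1
  ext ω
  rw [lTimeIntegral, ← lintegral_indicator (measurableSet_timesBefore _)]
  rfl

end Measurability

/-! ### Restarted paths and the strong Markov property -/

section Shift

variable {Ω : Type*} {X : ℝ≥0 → Ω → ℝ} {y : ℝ} {ω : Ω}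

lemma lTimeIntegral_mono_time {Y : ℝ≥0 → Ω → ℝ≥0∞} {σ τ : Ω → WithTop ℝ≥0} (h : σ ω ≤ τ ω) :
    lTimeIntegral Y σ ω ≤ lTimeIntegral Y τ ω :=
  lintegral_mono_set (timesBefore_mono h)

lemma lTimeIntegral_mono_process {Y Z : ℝ≥0 → Ω → ℝ≥0∞} {τ : Ω → WithTop ℝ≥0}
    (h : ∀ s : ℝ≥0, (s : WithTop ℝ≥0) < τ ω → Y s ω ≤ Z s ω) :
    lTimeIntegral Y τ ω ≤ lTimeIntegral Z τ ω :=
  setLIntegral_mono' (measurableSet_timesBefore _) fun _ hs => h _ hs.2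

/-- Splitting a time integral at a finite time `T`. -/
lemma lTimeIntegral_add (Y : ℝ≥0 → Ω → ℝ≥0∞) {τ D : Ω → WithTop ℝ≥0} {T : ℝ≥0}
    (h : τ ω = T + D ω) :
    lTimeIntegral Y τ ω =
      lTimeIntegral Y (fun _ => (T : WithTop ℝ≥0)) ω +
        lTimeIntegral (fun t => Y (T + t)) D ω := by
  have hmem : ∀ s : ℝ, (T : ℝ) + s ∈ timesBefore (τ ω) \ timesBefore (T : WithTop ℝ≥0) ↔
      s ∈ timesBefore (D ω) := by
    intro s
    simp only [timesBefore, Set.mem_sdiff, Set.mem_ofPred_eq, WithTop.coe_lt_coe, not_and, not_lt,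
      h]
    constructor
    · rintro ⟨⟨h0, h1⟩, h2⟩
      have h3 : (T : ℝ) ≤ T + s := by
        have := h2 h0
        rwa [← NNReal.coe_le_coe, Real.coe_toNNReal _ h0] at this
      have hs : 0 ≤ s := by linarith
      refine ⟨hs, ?_⟩
      rw [Real.toNNReal_add T.coe_nonneg hs, Real.toNNReal_coe] at h1
      by_contra! hlt
      exact absurd h1 (not_lt.2 (by push_cast; gcongr))
    · rintro ⟨hs, h1⟩
      rw [Real.toNNReal_add T.coe_nonneg hs, Real.toNNReal_coe]
      refine ⟨⟨add_nonneg T.coe_nonneg hs, ?_⟩, fun _ => le_self_add⟩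
      push_cast
      exact WithTop.add_lt_add_left WithTop.coe_ne_top h1
  have hsub : timesBefore (T : WithTop ℝ≥0) ⊆ timesBefore (τ ω) :=
    timesBefore_mono (h ▸ le_self_add)
  have hmeas := (measurableSet_timesBefore (τ ω)).diff
    (measurableSet_timesBefore (T : WithTop ℝ≥0))
  rw [lTimeIntegral, ← Set.union_sdiff_cancel hsub, lintegral_union hmeas Set.disjoint_sdiff_right,
    lTimeIntegral]
  congr 1
  rw [lTimeIntegral, ← lintegral_indicator hmeas,
    ← lintegral_indicator (measurableSet_timesBefore _), ← lintegral_add_left_eq_self _ (T : ℝ)]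
  refine lintegral_congr fun s => ?_
  by_cases hs : s ∈ timesBefore (D ω)
  · rw [Set.indicator_of_mem ((hmem s).2 hs), Set.indicator_of_mem hs,
      Real.toNNReal_add T.coe_nonneg hs.1, Real.toNNReal_coe]
  · rw [Set.indicator_of_notMem (mt (hmem s).1 hs), Set.indicator_of_notMem hs]

lemma lTimeIntegral_congr_time {Y : ℝ≥0 → Ω → ℝ≥0∞} {σ τ : Ω → WithTop ℝ≥0} (h : σ ω = τ ω) :
    lTimeIntegral Y σ ω = lTimeIntegral Y τ ω := by
  rw [lTimeIntegral, h, lTimeIntegral]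

lemma bddAbove_of_lt_firstPassage {t : ℝ≥0} (ht : (t : WithTop ℝ≥0) < firstPassage X y ω) :
    BddAbove ((fun r => X r ω) '' Set.Iic t) := by
  refine ⟨y, ?_⟩
  rintro _ ⟨r, hr, rfl⟩
  exact le_of_lt_firstPassage (lt_of_le_of_lt (WithTop.coe_le_coe.2 hr) ht)

lemma le_runningMax {r t : ℝ≥0} (hrt : r ≤ t) (ht : (t : WithTop ℝ≥0) < firstPassage X y ω) :
    X r ω ≤ runningMax X t ω :=
  le_csSup (bddAbove_of_lt_firstPassage ht) ⟨r, hrt, rfl⟩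

lemma runningMax_le {b : ℝ} {t : ℝ≥0} (h : ∀ r ≤ t, X r ω ≤ b) : runningMax X t ω ≤ b :=
  csSup_le ⟨_, Set.mem_image_of_mem _ (Set.mem_Iic.2 le_rfl)⟩ <| by
    rintro _ ⟨r, hr, rfl⟩
    exact h r hr

lemma add_lt_firstPassage {T t : ℝ≥0} (hT : (T : WithTop ℝ≥0) < firstPassage X y ω)
    (ht : (t : WithTop ℝ≥0) < firstPassage (fun t => X (T + t)) y ω) :
    ((T + t : ℝ≥0) : WithTop ℝ≥0) < firstPassage X y ω := by
  rw [firstPassage_shift hT]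
  push_cast
  exact WithTop.add_lt_add_left WithTop.coe_ne_top ht

/-- Restarting the path lowers its running maximum. -/
lemma runningMax_shift_le {T t : ℝ≥0} (hT : (T : WithTop ℝ≥0) < firstPassage X y ω)
    (ht : (t : WithTop ℝ≥0) < firstPassage (fun t => X (T + t)) y ω) :
    runningMax (fun t => X (T + t)) t ω ≤ runningMax X (T + t) ω :=
  runningMax_le fun _ hr =>
    le_runningMax (add_le_add_right hr T) (add_lt_firstPassage hT ht)

/-- Restarting the path at a first passage time does not change its running maximum. -/
lemma runningMax_shift_eq (hX : ∀ ω t, ContinuousWithinAt (fun s => X s ω) (Set.Ici t) t)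
    {b : ℝ} {T t : ℝ≥0} (hTb : firstPassage X b ω = T)
    (hT : (T : WithTop ℝ≥0) < firstPassage X y ω)
    (ht : (t : WithTop ℝ≥0) < firstPassage (fun t => X (T + t)) y ω) :
    runningMax (fun t => X (T + t)) t ω = runningMax X (T + t) ω := by
  refine le_antisymm (runningMax_shift_le hT ht) (runningMax_le fun r hr => ?_)
  rcases lt_or_ge r T with hrT | hrT
  · calc X r ω ≤ b := le_of_lt_firstPassage (by rw [hTb]; exact_mod_cast hrT)
      _ ≤ X (T + 0) ω := by rw [add_zero]; exact le_apply_firstPassage hX hTb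
      _ ≤ _ := le_runningMax (X := fun t => X (T + t)) zero_le ht
  · obtain ⟨s, rfl⟩ := exists_add_of_le hrT
    exact le_runningMax (X := fun t => X (T + t)) (le_of_add_le_add_left hr) ht

lemma stoppedValue_firstPassage_shift {T : ℝ≥0} (hT : (T : WithTop ℝ≥0) < firstPassage X y ω)
    (hfin : firstPassage X y ω < ⊤) :
    stoppedValue (fun t => X (T + t)) (firstPassage (fun t => X (T + t)) y) ω =
      stoppedValue X (firstPassage X y) ω := by
  have h := firstPassage_shift hT
  unfold stoppedValue
  rw [h] at hfin ⊢
  have h2 : firstPassage (fun t => X (T + t)) y ω ≠ ⊤ := fun h3 => by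
    rw [h3, WithTop.add_top] at hfin
    exact lt_irrefl _ hfin
  lift firstPassage (fun t => X (T + t)) y ω to ℝ≥0 using h2 with d
  rw [← WithTop.coe_add]
  rfl

lemma le_stoppedValue_firstPassage
    (hX : ∀ ω t, ContinuousWithinAt (fun s => X s ω) (Set.Ici t) t)
    (hfin : firstPassage X y ω < ⊤) : y ≤ stoppedValue X (firstPassage X y) ω := by
  unfold stoppedValue
  lift firstPassage X y ω to ℝ≥0 using hfin.ne with T hT
  exact le_apply_firstPassage hX hT.symm

end Shift

/-- The space of right-continuous paths, with the `σ`-algebra generated by the coordinates. -/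
abbrev RightContPath : Type :=
  {w : ℝ≥0 → ℝ // ∀ t, ContinuousWithinAt w (Set.Ici t) t}

/-- The coordinate process on the space of right-continuous paths. -/
def coord (t : ℝ≥0) (w : RightContPath) : ℝ := w.1 t

lemma measurable_coord (t : ℝ≥0) : Measurable (coord t) :=
  (measurable_pi_apply t).comp measurable_subtype_coe

lemma coord_rightContinuous (w : RightContPath) (t : ℝ≥0) :
    ContinuousWithinAt (fun s => coord s w) (Set.Ici t) t :=
  w.2 t

section Markov

variable {Ω : Type*} {m : MeasurableSpace Ω} {X : ℝ≥0 → Ω → ℝ}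
  {P : ℝ → Measure Ω} {F : Filtration ℝ≥0 m}

/-- The path of a right-continuous process. -/
def path (hX : ∀ ω t, ContinuousWithinAt (fun s => X s ω) (Set.Ici t) t) (ω : Ω) :
    RightContPath :=
  ⟨fun t => X t ω, hX ω⟩

lemma rightContinuous_shift (hX : ∀ ω t, ContinuousWithinAt (fun s => X s ω) (Set.Ici t) t)
    (T : ℝ≥0) (ω : Ω) (t : ℝ≥0) :
    ContinuousWithinAt (fun s => X (T + s) ω) (Set.Ici t) t := by
  have h1 : ContinuousWithinAt (fun s => T + s) (Set.Ici t) t :=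
    (continuous_const.add continuous_id).continuousWithinAt
  exact (hX ω (T + t)).comp h1 fun s hs => add_le_add_right hs T

/-- The path of a right-continuous process restarted at time `T`. -/
def shiftPath (hX : ∀ ω t, ContinuousWithinAt (fun s => X s ω) (Set.Ici t) t) (T : ℝ≥0)
    (ω : Ω) : RightContPath :=
  path (rightContinuous_shift hX T) ω

lemma measurable_path (hm : ∀ t, Measurable (X t))
    (hX : ∀ ω t, ContinuousWithinAt (fun s => X s ω) (Set.Ici t) t) : Measurable (path hX) :=
  (measurable_pi_lambda _ fun t => hm t).subtype_mk

lemma IsStrongMarkov.measurable (hX : IsStrongMarkov X P F) (t : ℝ≥0) : Measurable (X t) :=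
  (hX.adapted t).mono (F.le t) le_rfl

/-- The strong Markov property for measurable functionals of right-continuous paths. -/
theorem IsStrongMarkov.setLIntegral_shiftPath (hX : IsStrongMarkov X P F)
    {τ : Ω → WithTop ℝ≥0} (hτ : IsStoppingTime F τ) (x : ℝ) {A : Set Ω}
    (hA : MeasurableSet[hτ.measurableSpace] A) (hfin : ∀ ω ∈ A, τ ω < ⊤)
    {Φ : RightContPath → ℝ≥0∞} (hΦ : Measurable Φ) :
    ∫⁻ ω in A, Φ (shiftPath hX.rightContinuous_paths (τ ω).untopA ω) ∂(P x) =
      ∫⁻ ω in A, ∫⁻ ω', Φ (path hX.rightContinuous_paths ω') ∂(P (stoppedValue X τ ω)) ∂(P x) := by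
  have hrc := hX.rightContinuous_paths
  have hpath : Measurable (path hrc) := measurable_path hX.measurable hrc
  have hshift : Measurable fun ω => shiftPath hrc (τ ω).untopA ω := by
    refine (measurable_pi_lambda _ fun t => ?_).subtype_mk
    exact (measurable_uncurry_of_rightContinuous hX.measurable hrc).comp
      ((hτ.measurable'.untopA.add_const t).prodMk measurable_id)
  have hXτ : Measurable (stoppedValue X τ) :=
    measurable_stoppedValue_of_rightContinuous hX.measurable hrc hτ.measurable'
  have hκ : Measurable fun z => (P z).map (path hrc) := by
    refine Measure.measurable_of_measurable_coe _ fun B hB => ?_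
    obtain ⟨B', hB', rfl⟩ := hB
    simp_rw [Measure.map_apply hpath (measurable_subtype_coe hB')]
    exact hX.measurable_law B' hB'
  have key : ((P x).restrict A).map (fun ω => shiftPath hrc (τ ω).untopA ω) =
      (((P x).restrict A).map (stoppedValue X τ)).bind fun z => (P z).map (path hrc) := by
    ext B hB
    have hκB : Measurable fun z => (P z).map (path hrc) B := (Measure.measurable_coe hB).comp hκ
    rw [Measure.bind_apply hB hκ.aemeasurable, lintegral_map hκB hXτ, Measure.map_apply hshift hB,
      Measure.restrict_apply (hshift hB)]
    simp_rw [Measure.map_apply hpath hB]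
    obtain ⟨B', hB', rfl⟩ := hB
    have h := hX.strong_markov τ hτ x A B' hA hB'
    have hA' : {ω | ω ∈ A ∧ τ ω < ⊤} = A := by
      ext ω
      exact ⟨fun h => h.1, fun h => ⟨h, hfin ω h⟩⟩
    rw [hA'] at h
    refine Eq.trans ?_ h
    congr 1
    ext ω
    exact ⟨fun h => ⟨h.2, hfin ω h.2, h.1⟩, fun h => ⟨h.2.2, h.1⟩⟩
  have hκΦ : Measurable fun z => ∫⁻ w, Φ w ∂((P z).map (path hrc)) :=
    (Measure.measurable_lintegral hΦ).comp hκ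
  rw [← lintegral_map (μ := (P x).restrict A) hΦ hshift, key,
    Measure.lintegral_bind hκ.aemeasurable hΦ.aemeasurable, lintegral_map hκΦ hXτ]
  simp_rw [lintegral_map hΦ hpath]

end Markov

/-! ### The maximum representation before a passage time -/

section Functionals

variable {Ω : Type*}

/-- The cost `∫_0^{τ_y} g (X_s) ds` accumulated before the first passage above `y`. -/
def costBefore (X : ℝ≥0 → Ω → ℝ) (g : ℝ → ℝ≥0∞) (y : ℝ) : Ω → ℝ≥0∞ :=
  lTimeIntegral (fun s ω => g (X s ω)) (firstPassage X y)

/-- The integral `∫_0^{τ_y} φ (sup_{r ≤ t} X_r) dt` of a function of the running maximum up to the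
first passage above `y`. -/
def maxCostBefore (X : ℝ≥0 → Ω → ℝ) (φ : ℝ → ℝ≥0∞) (y : ℝ) : Ω → ℝ≥0∞ :=
  lTimeIntegral (fun s ω => φ (runningMax X s ω)) (firstPassage X y)

/-- The gain `γ (X_{τ_y}) - γ y` due to the overshoot at the first passage above `y`. -/
def overshootGain (X : ℝ≥0 → Ω → ℝ) (γ : ℝ → ℝ) (y : ℝ) (ω : Ω) : ℝ≥0∞ :=
  ENNReal.ofReal (γ (stoppedValue X (firstPassage X y) ω) - γ y)

variable {m : MeasurableSpace Ω} {X : ℝ≥0 → Ω → ℝ}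

lemma measurable_costBefore (hm : ∀ t, Measurable (X t))
    (hX : ∀ ω t, ContinuousWithinAt (fun s => X s ω) (Set.Ici t) t) {g : ℝ → ℝ≥0∞}
    (hg : Measurable g) (y : ℝ) : Measurable (costBefore X g y) :=
  measurable_lTimeIntegral (hg.comp (measurable_uncurry_of_rightContinuous hm hX))
    (measurable_firstPassage hm hX y)

lemma measurable_maxCostBefore (hm : ∀ t, Measurable (X t))
    (hX : ∀ ω t, ContinuousWithinAt (fun s => X s ω) (Set.Ici t) t) {φ : ℝ → ℝ≥0∞}
    (hφ : Measurable φ) (y : ℝ) : Measurable (maxCostBefore X φ y) :=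
  measurable_lTimeIntegral (hφ.comp (measurable_runningMax hm hX))
    (measurable_firstPassage hm hX y)

lemma measurable_overshootGain (hm : ∀ t, Measurable (X t))
    (hX : ∀ ω t, ContinuousWithinAt (fun s => X s ω) (Set.Ici t) t) {γ : ℝ → ℝ}
    (hγ : Measurable γ) (y : ℝ) : Measurable (overshootGain X γ y) :=
  ((hγ.comp (measurable_stoppedValue_of_rightContinuous hm hX
    (measurable_firstPassage hm hX y))).sub_const _).ennreal_ofReal

lemma maxCostBefore_mono {φ ψ : ℝ → ℝ≥0∞} (h : ∀ z, φ z ≤ ψ z) {y : ℝ} {ω : Ω} :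
    maxCostBefore X φ y ω ≤ maxCostBefore X ψ y ω :=
  lTimeIntegral_mono_process fun _ _ => h _

lemma measurable_apply_toNNReal {Y : ℝ≥0 → Ω → ℝ}
    (hY : Measurable fun p : ℝ≥0 × Ω => Y p.1 p.2) (ω : Ω) :
    Measurable fun s : ℝ => Y s.toNNReal ω :=
  hY.comp (measurable_real_toNNReal.prodMk measurable_const)

lemma timeIntegral_eq_toReal {Y : ℝ≥0 → Ω → ℝ}
    (hY : Measurable fun p : ℝ≥0 × Ω => Y p.1 p.2) (h0 : ∀ s ω, 0 ≤ Y s ω)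
    (τ : Ω → WithTop ℝ≥0) (ω : Ω) :
    timeIntegral Y τ ω = (lTimeIntegral (fun s ω => ENNReal.ofReal (Y s ω)) τ ω).toReal :=
  integral_eq_lintegral_of_nonneg_ae (.of_forall fun _ => h0 _ _)
    (measurable_apply_toNNReal hY ω).aestronglyMeasurable

lemma timeIntegral_eq_sub {Y : ℝ≥0 → Ω → ℝ}
    (hY : Measurable fun p : ℝ≥0 × Ω => Y p.1 p.2) (τ : Ω → WithTop ℝ≥0) {ω : Ω}
    (hfin : lTimeIntegral (fun s ω => ENNReal.ofReal |Y s ω|) τ ω < ∞) :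
    timeIntegral Y τ ω = (lTimeIntegral (fun s ω => ENNReal.ofReal (Y s ω)) τ ω).toReal -
      (lTimeIntegral (fun s ω => ENNReal.ofReal (-Y s ω)) τ ω).toReal := by
  refine integral_eq_lintegral_pos_part_sub_lintegral_neg_part ?_
  refine ⟨(measurable_apply_toNNReal hY ω).aestronglyMeasurable, ?_⟩
  rw [hasFiniteIntegral_iff_norm]
  exact hfin

/-- The maximum representation as an identity between integrals in `[0, ∞]`, with all terms moved
to the side where they are non-negative. -/
lemma HasMaxRepresentation.lintegral_eq {P : ℝ → Measure Ω} {γ h f : ℝ → ℝ}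
    (hrep : HasMaxRepresentation X P γ h f) (hm : ∀ t, Measurable (X t))
    (hX : ∀ ω t, ContinuousWithinAt (fun s => X s ω) (Set.Ici t) t)
    (hγ : Monotone γ) (hh : Measurable h) (hh0 : ∀ z, 0 ≤ h z) (hf : Measurable f)
    {y z : ℝ} [IsProbabilityMeasure (P z)] (hzy : z ≤ y)
    (hfin : ∫⁻ ω, costBefore X (fun z => ENNReal.ofReal (h z)) y ω ∂(P z) < ∞) :
    ∫⁻ ω, costBefore X (fun z => ENNReal.ofReal (h z)) y ω ∂(P z) +
        ∫⁻ ω, maxCostBefore X (fun z => ENNReal.ofReal (f z)) y ω ∂(P z) =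
      ∫⁻ ω, maxCostBefore X (fun z => ENNReal.ofReal (-f z)) y ω ∂(P z) +
        ∫⁻ ω, overshootGain X γ y ω ∂(P z) + ENNReal.ofReal (γ y - γ z) ∧
    ∫⁻ ω, maxCostBefore X (fun z => ENNReal.ofReal (-f z)) y ω ∂(P z) < ∞ ∧
    ∫⁻ ω, overshootGain X γ y ω ∂(P z) < ∞ := by
  obtain ⟨hpass, habs, hnet, heq⟩ := hrep y z hzy
  have hXm := measurable_uncurry_of_rightContinuous hm hX
  have hMm := measurable_runningMax hm hX
  have hCm : Measurable (costBefore X (fun z => ENNReal.ofReal (h z)) y) :=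
    measurable_costBefore hm hX hh.ennreal_ofReal y
  have hJpm : Measurable (maxCostBefore X (fun z => ENNReal.ofReal (f z)) y) :=
    measurable_maxCostBefore hm hX hf.ennreal_ofReal y
  have hJnm : Measurable (maxCostBefore X (fun z => ENNReal.ofReal (-f z)) y) :=
    measurable_maxCostBefore hm hX hf.neg.ennreal_ofReal y
  have hJam : Measurable (maxCostBefore X (fun z => ENNReal.ofReal |f z|) y) :=
    measurable_maxCostBefore hm hX hf.abs.ennreal_ofReal y
  have hJa : ∫⁻ ω, maxCostBefore X (fun z => ENNReal.ofReal |f z|) y ω ∂(P z) < ∞ := habs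
  have hJp : ∫⁻ ω, maxCostBefore X (fun z => ENNReal.ofReal (f z)) y ω ∂(P z) < ∞ :=
    (lintegral_mono fun ω => maxCostBefore_mono fun _ =>
      ENNReal.ofReal_le_ofReal (le_abs_self _)).trans_lt hJa
  have hJn : ∫⁻ ω, maxCostBefore X (fun z => ENNReal.ofReal (-f z)) y ω ∂(P z) < ∞ :=
    (lintegral_mono fun ω => maxCostBefore_mono fun _ =>
      ENNReal.ofReal_le_ofReal (neg_le_abs _)).trans_lt hJa
  have hCint := integrable_toReal_of_lintegral_ne_top hCm.aemeasurable hfin.ne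
  -- The running cost is finite, so that the overshoot gain inherits the integrability of the
  -- net reward.
  have hval : (fun ω => γ (stoppedValue X (firstPassage X y) ω) - γ y) = fun ω =>
      netReward X γ h (firstPassage X y) ω +
        (costBefore X (fun z => ENNReal.ofReal (h z)) y ω).toReal - γ y := by
    ext ω
    rw [netReward, timeIntegral_eq_toReal (hh.comp hXm) (fun _ _ => hh0 _)]
    simp [costBefore]
  have hvint : Integrable (fun ω => γ (stoppedValue X (firstPassage X y) ω) - γ y) (P z) := by
    rw [hval]
    exact (hnet.add hCint).sub (integrable_const _)
  have hv0 : ∀ᵐ ω ∂(P z), 0 ≤ γ (stoppedValue X (firstPassage X y) ω) - γ y := by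
    filter_upwards [hpass] with ω hω
    exact sub_nonneg.2 (hγ (le_stoppedValue_firstPassage hX hω))
  have hG : ∫⁻ ω, overshootGain X γ y ω ∂(P z) < ∞ :=
    (hasFiniteIntegral_iff_ofReal hv0).1 hvint.2
  refine ⟨?_, hJn, hG⟩
  have h1 : ∫ ω, timeIntegral (fun t ω => f (runningMax X t ω)) (firstPassage X y) ω ∂(P z) =
      (∫⁻ ω, maxCostBefore X (fun z => ENNReal.ofReal (f z)) y ω ∂(P z)).toReal -
        (∫⁻ ω, maxCostBefore X (fun z => ENNReal.ofReal (-f z)) y ω ∂(P z)).toReal := by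
    rw [← integral_toReal hJpm.aemeasurable (ae_lt_top hJpm hJp.ne),
      ← integral_toReal hJnm.aemeasurable (ae_lt_top hJnm hJn.ne), ← integral_sub
      (integrable_toReal_of_lintegral_ne_top hJpm.aemeasurable hJp.ne)
      (integrable_toReal_of_lintegral_ne_top hJnm.aemeasurable hJn.ne)]
    refine integral_congr_ae ?_
    filter_upwards [ae_lt_top hJam hJa.ne] with ω hω
    exact timeIntegral_eq_sub (hf.comp hMm) _ hω
  have h2 : ∫ ω, netReward X γ h (firstPassage X y) ω ∂(P z) =
      (∫⁻ ω, overshootGain X γ y ω ∂(P z)).toReal + γ y -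
        (∫⁻ ω, costBefore X (fun z => ENNReal.ofReal (h z)) y ω ∂(P z)).toReal := by
    have h3 : ∫ ω, (γ (stoppedValue X (firstPassage X y) ω) - γ y) ∂(P z) =
        (∫⁻ ω, overshootGain X γ y ω ∂(P z)).toReal :=
      integral_eq_lintegral_of_nonneg_ae hv0 hvint.1
    have hsum : Integrable (fun ω => netReward X γ h (firstPassage X y) ω +
        (costBefore X (fun z => ENNReal.ofReal (h z)) y ω).toReal) (P z) := hnet.add hCint
    rw [hval, integral_sub hsum (integrable_const _), integral_add hnet hCint,
      integral_toReal hCm.aemeasurable (ae_lt_top hCm hfin.ne), integral_const, probReal_univ,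
      one_smul] at h3
    linarith
  rw [h1, h2] at heq
  have hγ' : 0 ≤ γ y - γ z := sub_nonneg.2 (hγ hzy)
  refine (ENNReal.toReal_eq_toReal_iff' (ENNReal.add_ne_top.2 ⟨hfin.ne, hJp.ne⟩)
    (ENNReal.add_ne_top.2 ⟨ENNReal.add_ne_top.2 ⟨hJn.ne, hG.ne⟩, ENNReal.ofReal_ne_top⟩)).1 ?_
  rw [ENNReal.toReal_add hfin.ne hJp.ne, ENNReal.toReal_add
    (ENNReal.add_ne_top.2 ⟨hJn.ne, hG.ne⟩) ENNReal.ofReal_ne_top,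
    ENNReal.toReal_add hJn.ne hG.ne, ENNReal.toReal_ofReal hγ']
  linarith

/-- A function of the running maximum which vanishes above the level `b` collects nothing along a
path started above `b`. Applied to the positive part of `f`. -/
lemma maxCostBefore_eq_zero_of_start {φ : ℝ → ℝ≥0∞} {b y : ℝ} (hφ : ∀ z, b ≤ z → φ z = 0)
    {ω : Ω} (hb : b ≤ X 0 ω) : maxCostBefore X φ y ω = 0 := by
  refine le_antisymm ?_ zero_le
  calc maxCostBefore X φ y ω ≤ lTimeIntegral (fun _ _ => 0) (firstPassage X y) ω :=
        lTimeIntegral_mono_process fun s hs =>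
          (hφ _ (hb.trans (le_runningMax zero_le hs))).le
    _ = 0 := lintegral_zero

/-- A function of the running maximum which vanishes below the level `b` collects nothing before the
first passage above `b`. -/
lemma maxCostBefore_eq_zero {φ : ℝ → ℝ≥0∞} {b : ℝ} (hφ : ∀ z ≤ b, φ z = 0) (ω : Ω) :
    maxCostBefore X φ b ω = 0 := by
  refine le_antisymm ?_ zero_le
  calc maxCostBefore X φ b ω ≤ lTimeIntegral (fun _ _ => 0) (firstPassage X b) ω :=
        lTimeIntegral_mono_process fun s hs =>
          (hφ _ (runningMax_le fun r hr => le_of_lt_firstPassage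
            (lt_of_le_of_lt (WithTop.coe_le_coe.2 hr) hs))).le
    _ = 0 := lintegral_zero

/-- The integral of a monotone function of the running maximum decreases when the path is
restarted. -/
lemma maxCostBefore_shift_le {φ : ℝ → ℝ≥0∞} (hφ : Monotone φ) {y : ℝ} {T : ℝ≥0} {ω : Ω}
    (hT : (T : WithTop ℝ≥0) < firstPassage X y ω) :
    maxCostBefore (fun t => X (T + t)) φ y ω ≤ maxCostBefore X φ y ω := by
  rw [maxCostBefore, maxCostBefore, lTimeIntegral_add _ (D := firstPassage (fun t => X (T + t)) y)
    (firstPassage_shift hT)]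
  refine le_add_left (lTimeIntegral_mono_process fun s hs => ?_)
  exact hφ (runningMax_shift_le hT hs)

/-- If the path is restarted at the first passage above `b`, the integral of a function of the
running maximum which vanishes below `b` does not decrease. -/
lemma maxCostBefore_le_shift (hX : ∀ ω t, ContinuousWithinAt (fun s => X s ω) (Set.Ici t) t)
    {φ : ℝ → ℝ≥0∞} {b y : ℝ} (hφ : ∀ z ≤ b, φ z = 0) {T : ℝ≥0} {ω : Ω}
    (hTb : firstPassage X b ω = T) (hT : (T : WithTop ℝ≥0) < firstPassage X y ω) :
    maxCostBefore X φ y ω ≤ maxCostBefore (fun t => X (T + t)) φ y ω := by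
  have h0 : lTimeIntegral (fun s ω => φ (runningMax X s ω)) (fun _ => (T : WithTop ℝ≥0)) ω = 0 := by
    rw [← maxCostBefore_eq_zero (X := X) hφ ω]
    exact lTimeIntegral_congr_time hTb.symm
  rw [maxCostBefore, maxCostBefore, lTimeIntegral_add _ (D := firstPassage (fun t => X (T + t)) y)
    (firstPassage_shift hT), h0, zero_add]
  exact lTimeIntegral_mono_process fun s hs => (runningMax_shift_eq hX hTb hT hs ▸ le_rfl)

lemma costBefore_eq_add_shift {g : ℝ → ℝ≥0∞} {y : ℝ} {τ : Ω → WithTop ℝ≥0} {ω : Ω}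
    (hτ : τ ω < firstPassage X y ω) :
    costBefore X g y ω = lTimeIntegral (fun s ω => g (X s ω)) τ ω +
      costBefore (fun t => X ((τ ω).untopA + t)) g y ω := by
  have hne : τ ω ≠ ⊤ := (hτ.trans_le le_top).ne
  obtain ⟨T, hT⟩ := WithTop.ne_top_iff_exists.1 hne
  rw [← hT] at hτ
  have h1 : (τ ω).untopA = T := by rw [← hT]; rfl
  rw [h1, costBefore, lTimeIntegral_add _ (D := firstPassage (fun t => X (T + t)) y)
    (firstPassage_shift hτ), lTimeIntegral_congr_time (σ := fun _ => (T : WithTop ℝ≥0)) hT]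
  rfl

lemma overshootGain_shift {γ : ℝ → ℝ} {y : ℝ} {T : ℝ≥0} {ω : Ω}
    (hT : (T : WithTop ℝ≥0) < firstPassage X y ω) (hfin : firstPassage X y ω < ⊤) :
    overshootGain (fun t => X (T + t)) γ y ω = overshootGain X γ y ω := by
  rw [overshootGain, stoppedValue_firstPassage_shift hT hfin, overshootGain]

end Functionals

/-! ### Comparison of stopping times -/

section Comparison

variable {Ω : Type*} {m : MeasurableSpace Ω} {X : ℝ≥0 → Ω → ℝ} {P : ℝ → Measure Ω}
  {F : Filtration ℝ≥0 m} {γ h f : ℝ → ℝ}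

lemma measurableSet_lt_firstPassage (hX : IsStrongMarkov X P F) {τ : Ω → WithTop ℝ≥0}
    (hτ : IsStoppingTime F τ) (y : ℝ) :
    MeasurableSet[hτ.measurableSpace] {ω | τ ω < firstPassage X y ω} := by
  have h1 := (isStoppingTime_firstPassage hX.rightContinuous_filtration hX.adapted
    hX.rightContinuous_paths y).measurableSet_stopping_time_le hτ
  convert h1.compl using 1
  ext ω
  simp

/-- Restarting at an arbitrary stopping time `τ` before the passage above `y`, and bounding the
negative part of `f` at the running maximum after `τ` by its value at the running maximum since
time `0`. -/
theorem HasMaxRepresentation.lintegral_costBefore_le (hrep : HasMaxRepresentation X P γ h f)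
    (hX : IsStrongMarkov X P F) (hγ : Monotone γ) (hh : Measurable h) (hh0 : ∀ z, 0 ≤ h z)
    (hf : Measurable f) (hφ : Monotone fun z => ENNReal.ofReal (-f z)) {x y : ℝ} (hxy : x ≤ y)
    (hfin : ∀ z, ∫⁻ ω, costBefore X (fun z => ENNReal.ofReal (h z)) y ω ∂(P z) < ∞)
    {τ : Ω → WithTop ℝ≥0} (hτ : IsStoppingTime F τ) :
    ∫⁻ ω, costBefore X (fun z => ENNReal.ofReal (h z)) y ω ∂(P x) ≤
      ∫⁻ ω, lTimeIntegral (fun s ω => ENNReal.ofReal (h (X s ω))) τ ω ∂(P x) +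
        ∫⁻ ω, ENNReal.ofReal (γ y - γ (stoppedValue X τ ω)) ∂(P x) +
      ∫⁻ ω, (maxCostBefore X (fun z => ENNReal.ofReal (-f z)) y ω + overshootGain X γ y ω)
        ∂(P x) := by
  have hrc := hX.rightContinuous_paths
  have hm := hX.measurable
  have hprob := hX.isProbabilityMeasure
  set g : ℝ → ℝ≥0∞ := fun z => ENNReal.ofReal (h z)
  set φ : ℝ → ℝ≥0∞ := fun z => ENNReal.ofReal (-f z)
  have hg : Measurable g := hh.ennreal_ofReal
  have hφm : Measurable φ := hf.neg.ennreal_ofReal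
  have hpass := (hrep y x hxy).1
  set A := {ω | τ ω < firstPassage X y ω}
  have hA : MeasurableSet[hτ.measurableSpace] A := measurableSet_lt_firstPassage hX hτ y
  have hAm : MeasurableSet A := hτ.measurableSpace_le _ hA
  have hAfin : ∀ ω ∈ A, τ ω < ⊤ := fun ω hω => lt_of_lt_of_le hω le_top
  have hXτ : Measurable (stoppedValue X τ) :=
    measurable_stoppedValue_of_rightContinuous hm hrc hτ.measurable'
  have hU : Measurable fun ω => ENNReal.ofReal (γ y - γ (stoppedValue X τ ω)) :=
    (measurable_const.sub (hγ.measurable.comp hXτ)).ennreal_ofReal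
  have hL : Measurable (lTimeIntegral (fun s ω => g (X s ω)) τ) :=
    measurable_lTimeIntegral (hg.comp (measurable_uncurry_of_rightContinuous hm hrc))
      hτ.measurable'
  have hshift : ∀ ω ∈ A, ∃ T : ℝ≥0, (τ ω).untopA = T ∧ (T : WithTop ℝ≥0) < firstPassage X y ω := by
    intro ω hω
    obtain ⟨T, hT⟩ := WithTop.ne_top_iff_exists.1 (hAfin ω hω).ne
    have h1 : τ ω < firstPassage X y ω := hω
    rw [← hT] at h1 ⊢
    exact ⟨T, rfl, h1⟩
  have hΦ₁ : Measurable (costBefore coord g y) :=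
    measurable_costBefore measurable_coord coord_rightContinuous hg y
  have hΦ₂ : Measurable fun w => maxCostBefore coord φ y w + overshootGain coord γ y w :=
    (measurable_maxCostBefore measurable_coord coord_rightContinuous hφm y).add
      (measurable_overshootGain measurable_coord coord_rightContinuous hγ.measurable y)
  have hMarkov : ∫⁻ ω in A, costBefore (fun t => X ((τ ω).untopA + t)) g y ω ∂(P x) ≤
      ∫⁻ ω in A, (maxCostBefore X φ y ω + overshootGain X γ y ω) ∂(P x) +
        ∫⁻ ω in A, ENNReal.ofReal (γ y - γ (stoppedValue X τ ω)) ∂(P x) := by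
    calc ∫⁻ ω in A, costBefore (fun t => X ((τ ω).untopA + t)) g y ω ∂(P x)
        = ∫⁻ ω in A, ∫⁻ ω', costBefore X g y ω' ∂(P (stoppedValue X τ ω)) ∂(P x) :=
          hX.setLIntegral_shiftPath hτ x hA hAfin hΦ₁
      _ ≤ ∫⁻ ω in A, (∫⁻ ω', (maxCostBefore X φ y ω' + overshootGain X γ y ω')
            ∂(P (stoppedValue X τ ω)) +
            ENNReal.ofReal (γ y - γ (stoppedValue X τ ω))) ∂(P x) := by
          refine setLIntegral_mono' hAm fun ω hω => ?_
          obtain ⟨T, hT, hTy⟩ := hshift ω hω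
          have hz : stoppedValue X τ ω ≤ y := by
            rw [stoppedValue, hT]
            exact le_of_lt_firstPassage hTy
          rw [lintegral_add_left (measurable_maxCostBefore hm hrc hφm y)]
          -- The positive part of `f` is dropped here.
          rw [← (hrep.lintegral_eq hm hrc hγ hh hh0 hf hz (hfin _)).1]
          exact le_self_add
      _ = ∫⁻ ω in A, (maxCostBefore (fun t => X ((τ ω).untopA + t)) φ y ω +
            overshootGain (fun t => X ((τ ω).untopA + t)) γ y ω) ∂(P x) +
          ∫⁻ ω in A, ENNReal.ofReal (γ y - γ (stoppedValue X τ ω)) ∂(P x) := by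
          rw [lintegral_add_right _ hU]
          congr 1
          exact (hX.setLIntegral_shiftPath hτ x hA hAfin hΦ₂).symm
      _ ≤ _ := by
          gcongr ?_ + _
          refine lintegral_mono_ae ?_
          filter_upwards [ae_restrict_of_ae hpass, ae_restrict_mem hAm] with ω hω hωA
          obtain ⟨T, hT, hTy⟩ := hshift ω hωA
          rw [hT, overshootGain_shift hTy hω]
          gcongr
          exact maxCostBefore_shift_le hφ hTy
  -- On `{τ < τ_y}` the cost splits at `τ`; on the complement it is part of the cost up to `τ`.
  have hin : ∫⁻ ω in A, costBefore X g y ω ∂(P x) ≤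
      ∫⁻ ω in A, lTimeIntegral (fun s ω => g (X s ω)) τ ω ∂(P x) +
        (∫⁻ ω, (maxCostBefore X φ y ω + overshootGain X γ y ω) ∂(P x) +
          ∫⁻ ω, ENNReal.ofReal (γ y - γ (stoppedValue X τ ω)) ∂(P x)) := by
    rw [setLIntegral_congr_fun hAm fun ω hω => costBefore_eq_add_shift hω, lintegral_add_left hL]
    gcongr
    exact hMarkov.trans (add_le_add (setLIntegral_le_lintegral _ _) (setLIntegral_le_lintegral _ _))
  have hout : ∫⁻ ω in Aᶜ, costBefore X g y ω ∂(P x) ≤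
      ∫⁻ ω in Aᶜ, lTimeIntegral (fun s ω => g (X s ω)) τ ω ∂(P x) :=
    setLIntegral_mono' hAm.compl fun ω hω => lTimeIntegral_mono_time (not_lt.1 hω)
  rw [← lintegral_add_compl _ hAm, ← lintegral_add_compl
    (lTimeIntegral (fun s ω => ENNReal.ofReal (h (X s ω))) τ) hAm]
  refine (add_le_add hin hout).trans (le_of_eq ?_)
  ring

/-- For the first passage time above the root `b` of `f`, restarting the path loses nothing: after
that time, `f` at the running maximum is non-positive and the running maximum of the restarted path
is the running maximum since time `0`. -/
theorem HasMaxRepresentation.lintegral_firstPassage_le (hrep : HasMaxRepresentation X P γ h f)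
    (hX : IsStrongMarkov X P F) (hγ : Monotone γ) (hh : Measurable h) (hh0 : ∀ z, 0 ≤ h z)
    (hf : Measurable f) {b : ℝ} (hfb : ∀ z ≤ b, 0 ≤ f z) (hbf : ∀ z, b ≤ z → f z ≤ 0)
    {x y : ℝ} (hxy : x ≤ y) (hby : b ≤ y)
    (hfin : ∀ z, ∫⁻ ω, costBefore X (fun z => ENNReal.ofReal (h z)) y ω ∂(P z) < ∞) :
    ∫⁻ ω, (maxCostBefore X (fun z => ENNReal.ofReal (-f z)) y ω + overshootGain X γ y ω) ∂(P x) +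
        (∫⁻ ω, costBefore X (fun z => ENNReal.ofReal (h z)) b ω ∂(P x) +
        ∫⁻ ω, ENNReal.ofReal (γ y - γ (stoppedValue X (firstPassage X b) ω)) ∂(P x)) ≤
      ∫⁻ ω, costBefore X (fun z => ENNReal.ofReal (h z)) y ω ∂(P x) +
        ∫⁻ ω, ENNReal.ofReal (γ (stoppedValue X (firstPassage X b) ω) - γ y) ∂(P x) := by
  have hrc := hX.rightContinuous_paths
  have hm := hX.measurable
  have hprob := hX.isProbabilityMeasure
  set g : ℝ → ℝ≥0∞ := fun z => ENNReal.ofReal (h z)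
  set φ : ℝ → ℝ≥0∞ := fun z => ENNReal.ofReal (-f z)
  have hg : Measurable g := hh.ennreal_ofReal
  have hφm : Measurable φ := hf.neg.ennreal_ofReal
  have hφ0 : ∀ z ≤ b, φ z = 0 := fun z hz =>
    ENNReal.ofReal_of_nonpos (neg_nonpos.2 (hfb z hz))
  have hpass := (hrep y x hxy).1
  set σ := firstPassage X b
  have hσ : IsStoppingTime F σ :=
    isStoppingTime_firstPassage hX.rightContinuous_filtration hX.adapted hrc b
  set A := {ω | σ ω < firstPassage X y ω}
  have hA : MeasurableSet[hσ.measurableSpace] A := measurableSet_lt_firstPassage hX hσ y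
  have hAm : MeasurableSet A := hσ.measurableSpace_le _ hA
  have hAfin : ∀ ω ∈ A, σ ω < ⊤ := fun ω hω => lt_of_lt_of_le hω le_top
  have hXσ : Measurable (stoppedValue X σ) :=
    measurable_stoppedValue_of_rightContinuous hm hrc hσ.measurable'
  have hU : Measurable fun ω => ENNReal.ofReal (γ y - γ (stoppedValue X σ ω)) :=
    (measurable_const.sub (hγ.measurable.comp hXσ)).ennreal_ofReal
  have hCb : Measurable (costBefore X g b) := measurable_costBefore hm hrc hg b
  have hR : Measurable fun ω => maxCostBefore X φ y ω + overshootGain X γ y ω :=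
    (measurable_maxCostBefore hm hrc hφm y).add (measurable_overshootGain hm hrc hγ.measurable y)
  have hshift : ∀ ω ∈ A, ∃ T : ℝ≥0, σ ω = T ∧ (σ ω).untopA = T ∧
      (T : WithTop ℝ≥0) < firstPassage X y ω := by
    intro ω hω
    obtain ⟨T, hT⟩ := WithTop.ne_top_iff_exists.1 (hAfin ω hω).ne
    have h1 : σ ω < firstPassage X y ω := hω
    rw [← hT] at h1 ⊢
    exact ⟨T, rfl, rfl, h1⟩
  have hΦ₁ : Measurable (costBefore coord g y) :=
    measurable_costBefore measurable_coord coord_rightContinuous hg y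
  have hΦ₂ : Measurable fun w => maxCostBefore coord φ y w + overshootGain coord γ y w :=
    (measurable_maxCostBefore measurable_coord coord_rightContinuous hφm y).add
      (measurable_overshootGain measurable_coord coord_rightContinuous hγ.measurable y)
  have hMarkov : ∫⁻ ω in A, (maxCostBefore X φ y ω + overshootGain X γ y ω) ∂(P x) +
        ∫⁻ ω in A, ENNReal.ofReal (γ y - γ (stoppedValue X σ ω)) ∂(P x) ≤
      ∫⁻ ω in A, costBefore (fun t => X ((σ ω).untopA + t)) g y ω ∂(P x) := by
    calc _ ≤ ∫⁻ ω in A, (maxCostBefore (fun t => X ((σ ω).untopA + t)) φ y ω +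
            overshootGain (fun t => X ((σ ω).untopA + t)) γ y ω) ∂(P x) +
          ∫⁻ ω in A, ENNReal.ofReal (γ y - γ (stoppedValue X σ ω)) ∂(P x) := by
          gcongr ?_ + _
          refine lintegral_mono_ae ?_
          filter_upwards [ae_restrict_of_ae hpass, ae_restrict_mem hAm] with ω hω hωA
          obtain ⟨T, hT, hT', hTy⟩ := hshift ω hωA
          rw [hT', overshootGain_shift hTy hω]
          gcongr
          exact maxCostBefore_le_shift hrc hφ0 hT hTy
      _ = ∫⁻ ω in A, (∫⁻ ω', (maxCostBefore X φ y ω' + overshootGain X γ y ω')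
            ∂(P (stoppedValue X σ ω)) +
            ENNReal.ofReal (γ y - γ (stoppedValue X σ ω))) ∂(P x) := by
          rw [lintegral_add_right _ hU]
          congr 1
          exact hX.setLIntegral_shiftPath hσ x hA hAfin hΦ₂
      _ ≤ ∫⁻ ω in A, ∫⁻ ω', costBefore X g y ω' ∂(P (stoppedValue X σ ω)) ∂(P x) := by
          refine setLIntegral_mono' hAm fun ω hω => ?_
          obtain ⟨T, hT, hT', hTy⟩ := hshift ω hω
          have hz : stoppedValue X σ ω ≤ y := by
            rw [stoppedValue, hT']
            exact le_of_lt_firstPassage hTy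
          have hbz : b ≤ stoppedValue X σ ω := by
            rw [stoppedValue, hT']
            exact le_apply_firstPassage hrc hT
          -- Started at or above `b`, the positive part of `f` contributes nothing, so that
          -- the representation is an equality without it.
          have hzero : ∫⁻ ω', maxCostBefore X (fun z => ENNReal.ofReal (f z)) y ω'
              ∂(P (stoppedValue X σ ω)) = 0 := by
            refine (lintegral_congr_ae ?_).trans lintegral_zero
            filter_upwards [hX.start (stoppedValue X σ ω)] with ω' hω'
            exact maxCostBefore_eq_zero_of_start
              (fun z hz => ENNReal.ofReal_of_nonpos (hbf z hz)) (hω' ▸ hbz)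
          rw [lintegral_add_left (measurable_maxCostBefore hm hrc hφm y),
            ← (hrep.lintegral_eq hm hrc hγ hh hh0 hf hz (hfin _)).1, hzero, add_zero]
      _ = _ := (hX.setLIntegral_shiftPath hσ x hA hAfin hΦ₁).symm
  -- On `{τ_b < τ_y}` the cost splits at `τ_b`; on the complement `τ_b = τ_y`, `f⁻` has not been
  -- charged, and the two sides agree.
  have hin : ∫⁻ ω in A, (maxCostBefore X φ y ω + overshootGain X γ y ω +
      (costBefore X g b ω + ENNReal.ofReal (γ y - γ (stoppedValue X σ ω)))) ∂(P x) ≤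
      ∫⁻ ω in A, (costBefore X g y ω + ENNReal.ofReal (γ (stoppedValue X σ ω) - γ y)) ∂(P x) := by
    have h1 : ∫⁻ ω in A, costBefore X g y ω ∂(P x) = ∫⁻ ω in A, costBefore X g b ω ∂(P x) +
        ∫⁻ ω in A, costBefore (fun t => X ((σ ω).untopA + t)) g y ω ∂(P x) := by
      rw [setLIntegral_congr_fun hAm fun ω hω => costBefore_eq_add_shift hω]
      exact lintegral_add_left hCb _
    rw [lintegral_add_left hR, lintegral_add_left hCb,
      lintegral_add_left (measurable_costBefore hm hrc hg y), h1]
    calc _ = ∫⁻ ω in A, costBefore X g b ω ∂(P x) +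
          (∫⁻ ω in A, (maxCostBefore X φ y ω + overshootGain X γ y ω) ∂(P x) +
            ∫⁻ ω in A, ENNReal.ofReal (γ y - γ (stoppedValue X σ ω)) ∂(P x)) := by ring
      _ ≤ _ := by
        refine le_add_right ?_
        gcongr
  have hout : ∫⁻ ω in Aᶜ, (maxCostBefore X φ y ω + overshootGain X γ y ω +
      (costBefore X g b ω + ENNReal.ofReal (γ y - γ (stoppedValue X σ ω)))) ∂(P x) ≤
      ∫⁻ ω in Aᶜ, (costBefore X g y ω + ENNReal.ofReal (γ (stoppedValue X σ ω) - γ y))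
        ∂(P x) := by
    refine lintegral_mono_ae ?_
    filter_upwards [ae_restrict_of_ae hpass, ae_restrict_mem hAm.compl] with ω hω hωA
    have heq : firstPassage X y ω = σ ω := le_antisymm (not_lt.1 hωA) (firstPassage_mono hby)
    have h1 : maxCostBefore X φ y ω = 0 := by
      rw [← maxCostBefore_eq_zero (X := X) hφ0 ω]
      exact lTimeIntegral_congr_time heq
    have h2 : costBefore X g y ω = costBefore X g b ω := lTimeIntegral_congr_time heq
    have h3 : stoppedValue X (firstPassage X y) ω = stoppedValue X σ ω := by
      rw [stoppedValue, heq, stoppedValue]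
    have h4 : y ≤ stoppedValue X σ ω := h3 ▸ le_stoppedValue_firstPassage hrc hω
    rw [h1, h2, overshootGain, h3, ENNReal.ofReal_of_nonpos (sub_nonpos.2 (hγ h4)), zero_add,
      add_zero, add_comm]
  rw [← lintegral_add_left hCb, ← lintegral_add_left hR,
    ← lintegral_add_left (measurable_costBefore hm hrc hg y), ← lintegral_add_compl _ hAm,
    ← lintegral_add_compl (fun ω => costBefore X g y ω +
      ENNReal.ofReal (γ (stoppedValue X σ ω) - γ y)) hAm]
  exact add_le_add hin hout

end Comparison

section ExtExpectation

variable {Ω : Type*} {m : MeasurableSpace Ω} {μ : Measure Ω}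

lemma extExpectation_eq_integral {Z : Ω → ℝ} (hZ : Integrable Z μ) :
    extExpectation μ Z = ((∫ ω, Z ω ∂μ : ℝ) : EReal) := by
  have h1 : ∫⁻ ω, ENNReal.ofReal (Z ω) ∂μ ≠ ∞ := hZ.lintegral_lt_top.ne
  have h2 : ∫⁻ ω, ENNReal.ofReal (-Z ω) ∂μ ≠ ∞ := hZ.neg.lintegral_lt_top.ne
  rw [integral_eq_lintegral_pos_part_sub_lintegral_neg_part hZ, EReal.coe_sub,
    EReal.coe_ennreal_toReal h1, EReal.coe_ennreal_toReal h2, extExpectation]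

/-- A bound on the expectations of an increasing sequence of integrable truncations passes to the
limit. -/
lemma extExpectation_le_of_monotone {Z : Ω → ℝ} (hZ : Measurable Z) {W : ℕ → Ω → ℝ}
    (hW : ∀ n, Integrable (W n) μ) (hmono : ∀ ω, Monotone fun n => W n ω)
    (hlim : ∀ ω, ∃ n, W n ω = Z ω) (hle : ∀ n ω, W n ω ≤ Z ω) {v : ℝ}
    (hv : ∀ n, ∫ ω, W n ω ∂μ ≤ v) : extExpectation μ Z ≤ v := by
  have h1 : ∫⁻ ω, ENNReal.ofReal (Z ω - W 0 ω) ∂μ ≤ ENNReal.ofReal (v - ∫ ω, W 0 ω ∂μ) := by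
    have h2 : Filter.Tendsto (fun n => ∫⁻ ω, ENNReal.ofReal (W n ω - W 0 ω) ∂μ) Filter.atTop
        (nhds (∫⁻ ω, ENNReal.ofReal (Z ω - W 0 ω) ∂μ)) := by
      refine lintegral_tendsto_of_tendsto_of_monotone
        (fun n => ((hW n).1.aemeasurable.sub (hW 0).1.aemeasurable).ennreal_ofReal)
        (.of_forall fun ω i j hij =>
          ENNReal.ofReal_le_ofReal (sub_le_sub_right (hmono ω hij) _))
        (.of_forall fun ω => ?_)
      obtain ⟨n, hn⟩ := hlim ω
      refine tendsto_const_nhds.congr' ?_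
      filter_upwards [Filter.eventually_ge_atTop n] with k hk
      rw [le_antisymm (hle k ω) (hn ▸ hmono ω hk)]
    refine le_of_tendsto' h2 fun n => ?_
    have h3 : Integrable (fun ω => W n ω - W 0 ω) μ := (hW n).sub (hW 0)
    rw [← ofReal_integral_eq_lintegral_ofReal h3
      (.of_forall fun ω => sub_nonneg.2 (hmono ω zero_le)), integral_sub (hW n) (hW 0)]
    exact ENNReal.ofReal_le_ofReal (sub_le_sub_right (hv n) _)
  have h0 : 0 ≤ᵐ[μ] fun ω => Z ω - W 0 ω := .of_forall fun ω => sub_nonneg.2 (hle 0 ω)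
  have hint : Integrable (fun ω => Z ω - W 0 ω) μ :=
    ⟨hZ.aestronglyMeasurable.sub (hW 0).1,
      (hasFiniteIntegral_iff_ofReal h0).2 (h1.trans_lt ENNReal.ofReal_lt_top)⟩
  have hZint : Integrable Z μ :=
    (hint.add (hW 0)).congr (.of_forall fun ω => sub_add_cancel (Z ω) (W 0 ω))
  rw [extExpectation_eq_integral hZint, EReal.coe_le_coe_iff]
  have h3 : ∫ ω, (Z ω - W 0 ω) ∂μ ≤ v - ∫ ω, W 0 ω ∂μ := by
    rw [integral_eq_lintegral_of_nonneg_ae h0 hint.1]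
    exact ENNReal.toReal_le_of_le_ofReal (sub_nonneg.2 (hv 0)) h1
  rw [integral_sub hZint (hW 0)] at h3
  linarith

lemma integrable_sub_toReal [IsProbabilityMeasure μ] {v : Ω → ℝ} (hv : Measurable v)
    {L : Ω → ℝ≥0∞} (hL : Measurable L) (a : ℝ)
    (hG : ∫⁻ ω, ENNReal.ofReal (v ω - a) ∂μ ≠ ∞) (hU : ∫⁻ ω, ENNReal.ofReal (a - v ω) ∂μ ≠ ∞)
    (hLfin : ∫⁻ ω, L ω ∂μ ≠ ∞) :
    Integrable (fun ω => v ω - (L ω).toReal) μ ∧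
      ∫ ω, (v ω - (L ω).toReal) ∂μ = a + (∫⁻ ω, ENNReal.ofReal (v ω - a) ∂μ).toReal -
        (∫⁻ ω, ENNReal.ofReal (a - v ω) ∂μ).toReal - (∫⁻ ω, L ω ∂μ).toReal := by
  have hLint := integrable_toReal_of_lintegral_ne_top hL.aemeasurable hLfin
  have hvint : Integrable (fun ω => v ω - a) μ := by
    refine ⟨(hv.sub_const a).aestronglyMeasurable, ?_⟩
    rw [hasFiniteIntegral_iff_norm]
    calc ∫⁻ ω, ENNReal.ofReal ‖v ω - a‖ ∂μ
        ≤ ∫⁻ ω, (ENNReal.ofReal (v ω - a) + ENNReal.ofReal (a - v ω)) ∂μ := by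
          refine lintegral_mono fun ω => ?_
          rw [Real.norm_eq_abs]
          rcases abs_cases (v ω - a) with ⟨h, -⟩ | ⟨h, -⟩ <;> rw [h]
          · exact le_self_add
          · rw [neg_sub]
            exact le_add_self
      _ < ∞ := by
          rw [lintegral_add_left (hv.sub_const a).ennreal_ofReal]
          exact ENNReal.add_lt_top.2 ⟨hG.lt_top, hU.lt_top⟩
  have hv' : Integrable v μ :=
    (hvint.add (integrable_const a)).congr (.of_forall fun ω => sub_add_cancel (v ω) a)
  have h1 : ∫ ω, (v ω - a) ∂μ = (∫⁻ ω, ENNReal.ofReal (v ω - a) ∂μ).toReal -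
      (∫⁻ ω, ENNReal.ofReal (a - v ω) ∂μ).toReal := by
    rw [integral_eq_lintegral_pos_part_sub_lintegral_neg_part hvint]
    simp_rw [neg_sub]
  rw [integral_sub hv' (integrable_const a), integral_const, probReal_univ, one_smul] at h1
  refine ⟨hv'.sub hLint, ?_⟩
  rw [integral_sub hv' hLint, integral_toReal hL.aemeasurable (ae_lt_top hL hLfin)]
  linarith

end ExtExpectation

/-! ### The value function -/

section Value

variable {Ω : Type*} {m : MeasurableSpace Ω} {X : ℝ≥0 → Ω → ℝ} {P : ℝ → Measure Ω}
  {F : Filtration ℝ≥0 m} {γ h f : ℝ → ℝ}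

lemma netReward_eq (hm : ∀ t, Measurable (X t))
    (hX : ∀ ω t, ContinuousWithinAt (fun s => X s ω) (Set.Ici t) t)
    (hh : Measurable h) (hh0 : ∀ z, 0 ≤ h z) (τ : Ω → WithTop ℝ≥0) :
    netReward X γ h τ = fun ω => γ (stoppedValue X τ ω) -
      (lTimeIntegral (fun s ω => ENNReal.ofReal (h (X s ω))) τ ω).toReal := by
  ext ω
  rw [netReward, timeIntegral_eq_toReal (hh.comp (measurable_uncurry_of_rightContinuous hm hX))
    (fun _ _ => hh0 _)]

lemma expectedAbsIntegral_eq (hh0 : ∀ z, 0 ≤ h z) (μ : Measure Ω) (τ : Ω → WithTop ℝ≥0) :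
    expectedAbsIntegral μ (fun s ω => h (X s ω)) τ =
      ∫⁻ ω, lTimeIntegral (fun s ω => ENNReal.ofReal (h (X s ω))) τ ω ∂μ := by
  simp_rw [expectedAbsIntegral, abs_of_nonneg (hh0 _)]
  rfl

/-- The net reward at the first passage above the root `b` of `f` is integrable, and its expectation
is computed relative to the reference level `γ y`. -/
lemma HasMaxRepresentation.integral_netReward_firstPassage (hrep : HasMaxRepresentation X P γ h f)
    (hX : IsStrongMarkov X P F) (hγ : Monotone γ) (hh : Measurable h) (hh0 : ∀ z, 0 ≤ h z)
    (hf : Measurable f) {b x y : ℝ} (hxy : x ≤ y) (hby : b ≤ y)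
    (hfin : ∀ z, ∫⁻ ω, costBefore X (fun z => ENNReal.ofReal (h z)) y ω ∂(P z) < ∞) :
    ∫⁻ ω, ENNReal.ofReal (γ (stoppedValue X (firstPassage X b) ω) - γ y) ∂(P x) ≠ ∞ ∧
    ∫⁻ ω, ENNReal.ofReal (γ y - γ (stoppedValue X (firstPassage X b) ω)) ∂(P x) ≠ ∞ ∧
    ∫⁻ ω, costBefore X (fun z => ENNReal.ofReal (h z)) b ω ∂(P x) ≠ ∞ ∧
    Integrable (netReward X γ h (firstPassage X b)) (P x) ∧
    ∫ ω, netReward X γ h (firstPassage X b) ω ∂(P x) =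
      γ y + (∫⁻ ω, ENNReal.ofReal (γ (stoppedValue X (firstPassage X b) ω) - γ y) ∂(P x)).toReal -
        (∫⁻ ω, ENNReal.ofReal (γ y - γ (stoppedValue X (firstPassage X b) ω)) ∂(P x)).toReal -
        (∫⁻ ω, costBefore X (fun z => ENNReal.ofReal (h z)) b ω ∂(P x)).toReal := by
  have hrc := hX.rightContinuous_paths
  have hm := hX.measurable
  have hprob := hX.isProbabilityMeasure
  have hpass := (hrep y x hxy).1
  have hσm := measurable_firstPassage hm hrc b
  have hG : ∫⁻ ω, ENNReal.ofReal (γ (stoppedValue X (firstPassage X b) ω) - γ y) ∂(P x) ≠ ∞ := by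
    refine ((lintegral_mono_ae ?_).trans_lt
      (hrep.lintegral_eq hm hrc hγ hh hh0 hf hxy (hfin x)).2.2).ne
    filter_upwards [hpass] with ω hω
    -- The path can only exceed `y` at `τ_b` if `τ_b = τ_y`.
    rcases (firstPassage_mono (X := X) (ω := ω) hby).lt_or_eq with hlt | heq
    · have h1 : stoppedValue X (firstPassage X b) ω ≤ y := by
        unfold stoppedValue
        lift firstPassage X b ω to ℝ≥0 using (hlt.trans_le le_top).ne with T
        exact le_of_lt_firstPassage hlt
      rw [ENNReal.ofReal_of_nonpos (sub_nonpos.2 (hγ h1))]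
      exact zero_le
    · rw [overshootGain, stoppedValue, heq, stoppedValue]
  have hU : ∫⁻ ω, ENNReal.ofReal (γ y - γ (stoppedValue X (firstPassage X b) ω)) ∂(P x) ≠ ∞ := by
    refine ((lintegral_mono_ae (g := fun _ => ENNReal.ofReal (γ y - γ b)) ?_).trans_lt ?_).ne
    · filter_upwards [hpass] with ω hω
      exact ENNReal.ofReal_le_ofReal (sub_le_sub_left (hγ (le_stoppedValue_firstPassage hrc
        ((firstPassage_mono hby).trans_lt hω))) _)
    · simp
  have hC : ∫⁻ ω, costBefore X (fun z => ENNReal.ofReal (h z)) b ω ∂(P x) ≠ ∞ :=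
    ((lintegral_mono fun ω => lTimeIntegral_mono_time (firstPassage_mono hby)).trans_lt
      (hfin x)).ne
  refine ⟨hG, hU, hC, ?_⟩
  rw [netReward_eq hm hrc hh hh0]
  exact integrable_sub_toReal
    (hγ.measurable.comp (measurable_stoppedValue_of_rightContinuous hm hrc hσm))
    (measurable_costBefore hm hrc hh.ennreal_ofReal b) (γ y) hG hU hC

/-- No stopping time with integrable running cost does better than the first passage time above the
root `b` of `f`. The reward is truncated at a level `γ y`; the comparison is made before the passage
above `y`, and then `y` tends to infinity. -/
theorem HasMaxRepresentation.extExpectation_le (hrep : HasMaxRepresentation X P γ h f)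
    (hX : IsStrongMarkov X P F) (hγ : Monotone γ) (hh : Measurable h) (hh0 : ∀ z, 0 ≤ h z)
    (hf : Measurable f) (hφ : Monotone fun z => ENNReal.ofReal (-f z)) {b : ℝ}
    (hfb : ∀ z ≤ b, 0 ≤ f z) (hbf : ∀ z, b ≤ z → f z ≤ 0)
    (hfin : ∀ y z, ∫⁻ ω, costBefore X (fun z => ENNReal.ofReal (h z)) y ω ∂(P z) < ∞)
    {τ : Ω → WithTop ℝ≥0} (hτ : IsStoppingTime F τ) (x : ℝ)
    (hL : ∫⁻ ω, lTimeIntegral (fun s ω => ENNReal.ofReal (h (X s ω))) τ ω ∂(P x) < ∞) :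
    extExpectation (P x) (netReward X γ h τ) ≤
      ((∫ ω, netReward X γ h (firstPassage X b) ω ∂(P x) : ℝ) : EReal) := by
  have hrc := hX.rightContinuous_paths
  have hm := hX.measurable
  have hprob := hX.isProbabilityMeasure
  rw [netReward_eq (τ := τ) hm hrc hh hh0]
  set L := lTimeIntegral (fun s ω => ENNReal.ofReal (h (X s ω))) τ
  have hLm : Measurable L := measurable_lTimeIntegral
    (hh.ennreal_ofReal.comp (measurable_uncurry_of_rightContinuous hm hrc)) hτ.measurable'
  have hvm : Measurable fun ω => γ (stoppedValue X τ ω) :=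
    hγ.measurable.comp (measurable_stoppedValue_of_rightContinuous hm hrc hτ.measurable')
  -- If the negative part of the reward has infinite expectation, the extended expectation is `⊥`.
  by_cases hneg : ∫⁻ ω, ENNReal.ofReal (-(γ (stoppedValue X τ ω) - (L ω).toReal)) ∂(P x) = ∞
  · rw [extExpectation, hneg, EReal.coe_ennreal_top, EReal.sub_top]
    exact bot_le
  obtain ⟨N, hN⟩ := exists_nat_ge (max x b)
  -- Integrability of the negative part of the reward and of the cost bounds `γ (X_τ)` from below.
  have hbound : ∀ y : ℝ, ∫⁻ ω, ENNReal.ofReal (γ y - γ (stoppedValue X τ ω)) ∂(P x) ≠ ∞ := by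
    intro y
    refine ne_top_of_le_ne_top (b := ∫⁻ ω, (ENNReal.ofReal |γ y| +
      ENNReal.ofReal (-(γ (stoppedValue X τ ω) - (L ω).toReal))) ∂(P x)) ?_ ?_
    · rw [lintegral_add_left measurable_const]
      simpa using hneg
    · refine lintegral_mono fun ω => ?_
      refine (ENNReal.ofReal_le_ofReal ?_).trans ENNReal.ofReal_add_le
      linarith [le_abs_self (γ y), ENNReal.toReal_nonneg (a := L ω)]
  have htrunc : ∀ y : ℝ, Integrable
      (fun ω => min (γ (stoppedValue X τ ω)) (γ y) - (L ω).toReal) (P x) ∧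
      ∫ ω, (min (γ (stoppedValue X τ ω)) (γ y) - (L ω).toReal) ∂(P x) = γ y -
        (∫⁻ ω, ENNReal.ofReal (γ y - γ (stoppedValue X τ ω)) ∂(P x)).toReal -
        (∫⁻ ω, L ω ∂(P x)).toReal := by
    intro y
    have h1 : ∀ ω, ENNReal.ofReal (min (γ (stoppedValue X τ ω)) (γ y) - γ y) = 0 := fun ω =>
      ENNReal.ofReal_of_nonpos (sub_nonpos.2 (min_le_right _ _))
    have h2 : ∀ ω, ENNReal.ofReal (γ y - min (γ (stoppedValue X τ ω)) (γ y)) =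
        ENNReal.ofReal (γ y - γ (stoppedValue X τ ω)) := fun ω => by
      rcases le_total (γ (stoppedValue X τ ω)) (γ y) with hle | hle
      · rw [min_eq_left hle]
      · rw [min_eq_right hle, sub_self, ENNReal.ofReal_zero,
          ENNReal.ofReal_of_nonpos (sub_nonpos.2 hle)]
    have h3 := integrable_sub_toReal (μ := P x) (hvm.min (measurable_const (a := γ y))) hLm (γ y)
      (by simp [h1]) (by simpa only [h2] using hbound y) hL.ne
    simpa only [h1, h2, lintegral_zero, ENNReal.toReal_zero, add_zero] using h3
  refine extExpectation_le_of_monotone (hvm.sub hLm.ennreal_toReal)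
    (W := fun k ω => min (γ (stoppedValue X τ ω)) (γ (N + k)) - (L ω).toReal)
    (fun k => (htrunc _).1) (fun ω i j hij => ?_) (fun ω => ?_)
    (fun k ω => sub_le_sub_right (min_le_left _ _) _) (fun k => ?_)
  · refine sub_le_sub_right (min_le_min_left _ (hγ ?_)) _
    gcongr
  · obtain ⟨k, hk⟩ := exists_nat_ge (stoppedValue X τ ω)
    refine ⟨k, ?_⟩
    rw [min_eq_left (hγ (hk.trans (by simp)))]
    rfl
  · have hNy : (N : ℝ) ≤ N + k := by simp
    have hxy : x ≤ N + k := (le_max_left x b).trans (hN.trans hNy)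
    have hby : b ≤ N + k := (le_max_right x b).trans (hN.trans hNy)
    generalize (N + k : ℝ) = y at hxy hby
    obtain ⟨hG, hU, hC, -, hval⟩ :=
      hrep.integral_netReward_firstPassage hX hγ hh hh0 hf hxy hby (hfin y)
    rw [(htrunc y).2, hval]
    have h1 := hrep.lintegral_costBefore_le hX hγ hh hh0 hf hφ hxy (hfin y) hτ
    have h2 := hrep.lintegral_firstPassage_le hX hγ hh hh0 hf hfb hbf hxy hby (hfin y)
    -- Both inequalities are added; the finite running cost before the passage above `y` cancels.
    have h3 : ∫⁻ ω, costBefore X (fun z => ENNReal.ofReal (h z)) b ω ∂(P x) +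
        ∫⁻ ω, ENNReal.ofReal (γ y - γ (stoppedValue X (firstPassage X b) ω)) ∂(P x) ≤
        ∫⁻ ω, L ω ∂(P x) + ∫⁻ ω, ENNReal.ofReal (γ y - γ (stoppedValue X τ ω)) ∂(P x) +
        ∫⁻ ω, ENNReal.ofReal (γ (stoppedValue X (firstPassage X b) ω) - γ y) ∂(P x) := by
      refine (ENNReal.add_le_add_iff_left (hfin y x).ne).1 ?_
      calc _ ≤ _ := add_le_add_left h1 _
        _ = _ := add_assoc _ _ _
        _ ≤ _ := add_le_add_right h2 _
        _ = _ := by ring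
    have h4 := ENNReal.toReal_mono
      (ENNReal.add_ne_top.2 ⟨ENNReal.add_ne_top.2 ⟨hL.ne, hbound y⟩, hG⟩) h3
    rw [ENNReal.toReal_add hC hU, ENNReal.toReal_add (ENNReal.add_ne_top.2 ⟨hL.ne, hbound y⟩) hG,
      ENNReal.toReal_add hL.ne (hbound y)] at h4
    linarith

end Value

end

end OptStop

/-! ### Optimality of the threshold time -/

theorem mainTheorem1 {Ω : Type*} {m : MeasurableSpace Ω}
    (X : ℝ≥0 → Ω → ℝ) (P : ℝ → Measure Ω) (F : Filtration ℝ≥0 m)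
    (hX : OptStop.IsStrongMarkov X P F)
    (γ h f : ℝ → ℝ) (xbar : ℝ)
    (hγ_mono : Monotone γ) (hγ_diff : Differentiable ℝ γ)
    (hh_nonneg : ∀ z, 0 ≤ h z) (hh_cont : Continuous h)
    (hh_int : ∀ x y : ℝ, x < y → OptStop.expectedAbsIntegral (P x) (fun s ω => h (X s ω))
      (OptStop.firstPassage X y) < ∞)
    (hf_meas : Measurable f)
    (hf_rep : OptStop.HasMaxRepresentation X P γ h f)
    (hf_root : f xbar = 0) (hf_pos : ∀ z, z < xbar → 0 < f z)
    (hf_anti : StrictAntiOn f (Set.Ici xbar))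
    (hτ : ∀ x, OptStop.expectedTime (P x) (OptStop.firstPassage X xbar) < ∞) :
    OptStop.firstPassage X xbar ∈ OptStop.admissible X P F h ∧
    ∀ x : ℝ,
      Integrable (OptStop.netReward X γ h (OptStop.firstPassage X xbar)) (P x) ∧
      OptStop.value X P F γ h x =
        ((∫ ω, OptStop.netReward X γ h (OptStop.firstPassage X xbar) ω ∂(P x) : ℝ) : EReal) := by

  have hrc := hX.rightContinuous_paths
  have hσ := OptStop.isStoppingTime_firstPassage hX.rightContinuous_filtration hX.adapted hrc xbar
  have hcost : ∀ y z,
      ∫⁻ ω, OptStop.costBefore X (fun z => ENNReal.ofReal (h z)) y ω ∂(P z) < ∞ := by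
    intro y z
    -- The cost is only assumed finite for levels above the starting point: a higher level is used.
    have h1 := hh_int z (max z y + 1) (lt_of_le_of_lt (le_max_left z y) (lt_add_one _))
    rw [OptStop.expectedAbsIntegral_eq hh_nonneg] at h1
    refine (lintegral_mono fun ω => OptStop.lTimeIntegral_mono_time
      (OptStop.firstPassage_mono ?_)).trans_lt h1
    exact (le_max_right z y).trans (lt_add_one _).le
  have hfb : ∀ z ≤ xbar, 0 ≤ f z := fun z hz => by
    rcases hz.lt_or_eq with hlt | rfl
    · exact (hf_pos z hlt).le
    · exact hf_root.ge
  have hbf : ∀ z, xbar ≤ z → f z ≤ 0 := fun z hz =>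
    hf_root ▸ hf_anti.antitoneOn (Set.mem_Ici.2 le_rfl) hz hz
  have hφ : Monotone fun z => ENNReal.ofReal (-f z) := by
    intro u v huv
    rcases lt_or_ge u xbar with hu | hu
    · dsimp only
      rw [ENNReal.ofReal_of_nonpos (neg_nonpos.2 (hf_pos u hu).le)]
      exact zero_le
    · exact ENNReal.ofReal_le_ofReal
        (neg_le_neg (hf_anti.antitoneOn hu (Set.mem_Ici.2 (hu.trans huv)) huv))
  have hadm : OptStop.firstPassage X xbar ∈ OptStop.admissible X P F h :=
    ⟨hσ, fun x => ⟨hτ x, by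
      rw [OptStop.expectedAbsIntegral_eq hh_nonneg]
      exact hcost xbar x⟩⟩
  refine ⟨hadm, fun x => ?_⟩
  have hint : Integrable (OptStop.netReward X γ h (OptStop.firstPassage X xbar)) (P x) :=
    (hf_rep.integral_netReward_firstPassage hX hγ_mono hh_cont.measurable hh_nonneg hf_meas
      (le_max_left x xbar) (le_max_right x xbar) (hcost _)).2.2.2.1
  refine ⟨hint, le_antisymm (iSup₂_le fun τ hτ' => ?_) ?_⟩
  · refine hf_rep.extExpectation_le hX hγ_mono hh_cont.measurable hh_nonneg hf_meas hφ hfb hbf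
      hcost hτ'.1 x ?_
    rw [← OptStop.expectedAbsIntegral_eq hh_nonneg]
    exact (hτ'.2 x).2
  · rw [← OptStop.extExpectation_eq_integral hint]
    exact le_iSup₂ (f := fun τ _ => OptStop.extExpectation (P x) (OptStop.netReward X γ h τ)) _ hadm
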